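/- Fix $0<q<1$, let $\mathbb A=\{z\in\mathbb C: q<|z|<1\}$, $B_q=\{|z|=q\}$, $B_1=\{|z|=1\}$, $B=B_q\cup B_1$, and let $\mu=\mu_1+\mu_q$, where $\mu_j$ is the multiple of arclength measure on $B_j$ with $\mu_j(B_j)=2\pi$. For $\alpha\in[0,1)$ let $H^2_\alpha$ be the space of analytic functions $F$ on the universal cover $\{(r,t): q<r<1,\ t\in\mathbb R\}$ of $\mathbb A$ (with covering map $(r,t)\mapsto re^{it}$) that satisfy $F(r,t+2\pi)=e^{2\pi i\alpha}F(r,t)$ and have boundary values in $L^2(\mu)$, attained in the sense that $F(r,\cdot)$ converges in $L^2(0,2\pi)$ as $r\to1^-$ and as $r\to q^+$. Through these boundary values (taken on the branch $0<t\le2\pi$) $H^2_\alpha$ is a closed subspace of $L^2(\mu)$; let $P_\alpha$ be the orthogonal projection of $L^2(\mu)$ onto it. For a real-valued $\varphi\in L^\infty(\mu)$ the Toeplitz operator $T^\alpha_\varphi:H^2_\alpha\to H^2_\alpha$ is $T^\alpha_\varphi f=P_\alpha(\varphi f)$. Let $\varphi\in L^\infty(\mu)$ be real-valued and suppose that \[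 \operatorname{ess\,sup}_{B_q}\varphi=m<0<M=\operatorname{ess\,inf}_{B_1}\varphi \quad\text{or}\quad \operatorname{ess\,sup}_{B_1}\varphi=m<0<M=\operatorname{ess\,inf}_{B_q}\varphi . \] If \[ \int_B\log|\varphi-M|\,d\mu=-\infty\quad\text{or}\quad\int_B\log|\varphi-m|\,d\mu=-\infty \] (with $\log 0=-\infty$), then for every $\alpha\in[0,1)$ the operator $T^\alpha_\varphi$ has infinitely many eigenvalues in the interval $(m,M)$. -/

import Mathlib

open Set Filter Topology MeasureTheory
open scoped ENNReal

noncomputable section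

namespace AnnulusToeplitz

/-- Lebesgue measure `dt` on one period `(0, 2π]` of the angle. -/
abbrev angleMeasure : Measure ℝ := volume.restrict (Ioc 0 (2 * Real.pi))

/-- Arclength on the circle `|z| = r`, weighted so that its total mass is `2π`
(the image of `dt` under `t ↦ r * exp (i t)`). -/
def circleMeasure (r : ℝ) : Measure ℂ :=
  Measure.map (circleMap 0 r) angleMeasure

/-- The measure `μ = μ_1 + μ_q` carried by the boundary `B = B_1 ∪ B_q` of the annulus
`q < |z| < 1`; thus `L²(B)` is `Lp ℂ 2 (boundaryMeasure q)`. -/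
def boundaryMeasure (q : ℝ) : Measure ℂ := circleMeasure 1 + circleMeasure q

/-- `F (r, t)` is an analytic, modulus automorphic function of index `α` on the universal cover
`{(r, t) | q < r < 1}` of the annulus, whose covering map is `(r, t) ↦ r * exp (i t)`. Analyticity
is expressed in the global holomorphic coordinate `w = log r + i t` of the cover. The function
`0` is regarded as having every index. -/
structure IsAutomorphic (q α : ℝ) (F : ℝ × ℝ → ℂ) : Prop where
  analytic : DifferentiableOn ℂ (fun w : ℂ => F (Real.exp w.re, w.im))
    {w : ℂ | q < Real.exp w.re ∧ Real.exp w.re < 1}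
  index : ∀ r t : ℝ, q < r → r < 1 →
    F (r, t + 2 * Real.pi) = Complex.exp (2 * Real.pi * Complex.I * α) * F (r, t)

/-- `u` is the boundary value on the circle `|z| = s` of the (multivalued) function `F`, on the
branch `0 < t ≤ 2π`: `F (r, t) → u (s * exp (i t))` in `L²(dt)` as `r` tends to `s` along `l`. -/
def HasBoundaryValue (F : ℝ × ℝ → ℂ) (s : ℝ) (l : Filter ℝ) (u : ℂ → ℂ) : Prop :=
  Tendsto (fun r : ℝ => eLpNorm (fun t : ℝ => F (r, t) - u (circleMap 0 s t)) 2 angleMeasure) l (𝓝 0)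

/-- The function `exp (-i α t) f(t)`. -/
def twist (α : ℝ) (f : ℝ → ℂ) (t : ℝ) : ℂ := Complex.exp (-(α * t * Complex.I)) * f t

/-- The coefficient of `exp (i (n + α) t)` in `f`. -/
def coef (α : ℝ) (f : ℝ → ℂ) (n : ℤ) : ℂ := fourierCoeffOn Real.two_pi_pos (twist α f) n

lemma coef_eq (α : ℝ) (f : ℝ → ℂ) (n : ℤ) :
    coef α f n = (1 / (2 * Real.pi) : ℝ) • ∫ t, Complex.exp (-((n + α) * t * Complex.I)) * f t ∂angleMeasure := by
  rw [coef, fourierCoeffOn_eq_integral, sub_zero, intervalIntegral.integral_of_le Real.two_pi_pos.le]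
  congr 2
  ext t
  rw [fourier_coe_apply, twist, smul_eq_mul, ← mul_assoc, ← Complex.exp_add]
  congr 2
  have : (Real.pi : ℂ) ≠ 0 := by exact_mod_cast Real.pi_ne_zero
  push_cast
  field_simp
  ring

lemma memLp_exp_mul (β : ℝ) {f : ℝ → ℂ} {p : ℝ≥0∞} (hf : MemLp f p angleMeasure) :
    MemLp (fun t => Complex.exp (-((β : ℂ) * (t : ℝ) * Complex.I)) * f t) p angleMeasure := by
  refine hf.of_le ?_ (Eventually.of_forall fun t => ?_)
  · exact (by fun_prop : Continuous fun t : ℝ => Complex.exp (-(β * t * Complex.I))).aestronglyMeasurable.mul hf.1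
  · rw [norm_mul, show -((β:ℂ) * t * Complex.I) = ((-(β * t) : ℝ) : ℂ) * Complex.I by push_cast; ring,
      Complex.norm_exp_ofReal_mul_I, one_mul]

lemma norm_twist (α : ℝ) (f : ℝ → ℂ) (t : ℝ) : ‖twist α f t‖ = ‖f t‖ := by
  rw [twist, norm_mul, show -((α:ℂ) * t * Complex.I) = ((-(α * t) : ℝ) : ℂ) * Complex.I by push_cast; ring,
      Complex.norm_exp_ofReal_mul_I, one_mul]

lemma coef_tendsto {ι : Type*} {l : Filter ι} (α : ℝ) {f : ι → ℝ → ℂ} {g : ℝ → ℂ}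
    (hf : ∀ᶠ i in l, MemLp (f i) 2 angleMeasure) (hg : MemLp g 2 angleMeasure)
    (h : Tendsto (fun i => eLpNorm (fun t => f i t - g t) 2 angleMeasure) l (𝓝 0)) (n : ℤ) :
    Tendsto (fun i => coef α (f i) n) l (𝓝 (coef α g n)) := by
  simp only [coef_eq]
  refine Tendsto.const_smul ?_ _
  have e : ((n:ℂ) + α) = ((n + α : ℝ) : ℂ) := by push_cast; ring
  simp only [e]
  have one_two : (1 : ℝ≥0∞) ≤ 2 := by norm_num
  refine tendsto_integral_of_L1' _ (memLp_exp_mul _ hg).1 ?_ ?_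
  · filter_upwards [hf] with i hi
    exact (memLp_exp_mul _ hi).integrable one_two
  · have h2 : Tendsto (fun i => eLpNorm (fun t => f i t - g t) 2 angleMeasure *
        angleMeasure univ ^ (1 / (1 : ℝ≥0∞).toReal - 1 / (2 : ℝ≥0∞).toReal)) l (𝓝 0) := by
      have := ENNReal.Tendsto.mul_const (b := angleMeasure univ ^ (1 / (1 : ℝ≥0∞).toReal - 1 / (2 : ℝ≥0∞).toReal)) h
        (Or.inr (ENNReal.rpow_ne_top_of_nonneg (by norm_num) (by simp [angleMeasure, ENNReal.mul_eq_top])))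
      simpa using this
    refine tendsto_of_tendsto_of_tendsto_of_le_of_le' tendsto_const_nhds h2
      (Eventually.of_forall fun _ => zero_le) ?_
    filter_upwards [hf] with i hi
    refine le_trans (le_of_eq ?_) (eLpNorm_le_eLpNorm_mul_rpow_measure_univ one_two (hi.sub hg).1)
    refine eLpNorm_congr_norm_ae (Eventually.of_forall fun t => ?_)
    have := norm_twist (n + α) (fun t => f i t - g t) t
    rw [← this, twist, Pi.sub_apply, ← mul_sub]

lemma continuous_slice {q α : ℝ} {F : ℝ × ℝ → ℂ} (hF : IsAutomorphic q α F) (hq : 0 < q) {r : ℝ}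
    (h1 : q < r) (h2 : r < 1) : Continuous fun t => F (r, t) := by
  have h0 : 0 < r := hq.trans h1
  have := hF.analytic.continuousOn.comp_continuous
    (f := fun t : ℝ => (Real.log r : ℂ) + t * Complex.I) (by fun_prop)
    (fun t => by simp [Real.exp_log h0, h1, Real.log_neg h0 h2])
  refine this.congr fun t => ?_
  simp [Real.exp_log h0]

lemma memLp_slice {q α : ℝ} {F : ℝ × ℝ → ℂ} (hF : IsAutomorphic q α F) (hq : 0 < q) {r : ℝ}
    (h1 : q < r) (h2 : r < 1) : MemLp (fun t => F (r, t)) 2 angleMeasure := by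
  have hc := continuous_slice hF hq h1 h2
  obtain ⟨C, hC⟩ := isCompact_Icc.exists_bound_of_continuousOn (s := Icc 0 (2 * Real.pi)) hc.continuousOn
  refine MemLp.of_bound hc.aestronglyMeasurable C ?_
  filter_upwards [ae_restrict_mem measurableSet_Ioc] with t ht using hC t (Ioc_subset_Icc_self ht)

lemma coef_slice {q α : ℝ} {F : ℝ × ℝ → ℂ} (hF : IsAutomorphic q α F) (hq : 0 < q) (n : ℤ) {r s : ℝ}
    (hr : r ∈ Ioo q 1) (hs : s ∈ Ioo q 1) :
    ((s ^ (n + α : ℝ) : ℝ) : ℂ) * coef α (fun t => F (r, t)) n =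
      ((r ^ (n + α : ℝ) : ℝ) : ℂ) * coef α (fun t => F (s, t)) n := by
  set S := {w : ℂ | q < Real.exp w.re ∧ Real.exp w.re < 1} with hS
  set G : ℂ → ℂ := fun w => Complex.exp (-((n + α) * w)) * F (Real.exp w.re, w.im) with hG
  have hGd : DifferentiableOn ℂ G S := by
    refine DifferentiableOn.mul ?_ hF.analytic
    exact (by fun_prop : Differentiable ℂ fun w : ℂ => Complex.exp (-((n + α) * w))).differentiableOn
  have hr0 := hq.trans hr.1
  have hs0 := hq.trans hs.1
  have key : ∀ x ∈ Ioo q 1, coef α (fun t => F (x, t)) n =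
      ((x ^ (n + α : ℝ) : ℝ) : ℂ) *
        ((1 / (2 * Real.pi) : ℝ) • ∫ t in (0:ℝ)..2 * Real.pi, G (Real.log x + t * Complex.I)) := by
    intro x hx
    have hx0 := hq.trans hx.1
    rw [coef_eq, intervalIntegral.integral_of_le Real.two_pi_pos.le, mul_smul_comm,
      ← integral_const_mul]
    congr 2
    ext t
    simp only [hG]
    rw [← mul_assoc, Real.rpow_def_of_pos hx0, Complex.ofReal_exp, ← Complex.exp_add]
    simp [Real.exp_log hx0]
    left
    congr 1
    ring
  have rect := Complex.integral_boundary_rect_eq_zero_of_differentiableOn G (Real.log r)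
    (Real.log s + (2 * Real.pi : ℝ) * Complex.I) (hGd.mono ?_)
  · have per : ∀ x : ℝ, G (x + (2 * Real.pi : ℝ) * Complex.I) = G (x + (0:ℝ) * Complex.I) ∨ ¬ (q < Real.exp x ∧ Real.exp x < 1) := by
      intro x
      by_cases hx : q < Real.exp x ∧ Real.exp x < 1
      · left
        have := hF.index (Real.exp x) 0 hx.1 hx.2
        simp only [hG]
        simp at this ⊢
        rw [this, ← mul_assoc, ← Complex.exp_add]
        congr 1
        rw [Complex.exp_eq_exp_iff_exists_int]
        exact ⟨-n, by push_cast; ring⟩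
      · exact Or.inr hx
    have hh : (∫ x : ℝ in Real.log r..Real.log s, G (x + (2 * Real.pi : ℝ) * Complex.I)) =
        ∫ x : ℝ in Real.log r..Real.log s, G (x + (0:ℝ) * Complex.I) := by
      refine intervalIntegral.integral_congr fun x hx => (per x).resolve_right ?_
      push Not
      rw [mem_uIcc] at hx
      constructor
      · rw [← Real.log_lt_iff_lt_exp hq]
        have := Real.log_lt_log hq hr.1
        have := Real.log_lt_log hq hs.1
        rcases hx with hx | hx <;> linarith
      · rw [Real.exp_lt_one_iff]
        have := Real.log_neg hr0 hr.2
        have := Real.log_neg hs0 hs.2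
        rcases hx with hx | hx <;> linarith
    have e2 : ∫ t in (0:ℝ)..2 * Real.pi, G (Real.log s + t * Complex.I) =
        ∫ t in (0:ℝ)..2 * Real.pi, G (Real.log r + t * Complex.I) := by
      simp at rect hh
      rw [hh, sub_self, zero_add, ← mul_sub] at rect
      have := (mul_eq_zero.mp rect).resolve_left Complex.I_ne_zero
      simpa using sub_eq_zero.mp this
    rw [key r hr, key s hs, e2]
    ring
  · intro w hw
    rw [Complex.mem_reProdIm] at hw
    have hx := hw.1
    simp at hx
    rw [mem_uIcc] at hx
    constructor
    · rw [← Real.log_lt_iff_lt_exp hq]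
      have := Real.log_lt_log hq hr.1
      have := Real.log_lt_log hq hs.1
      rcases hx with hx | hx <;> linarith
    · rw [Real.exp_lt_one_iff]
      have := Real.log_neg hr0 hr.2
      have := Real.log_neg hs0 hs.2
      rcases hx with hx | hx <;> linarith


lemma summable_exp_abs (α δ : ℝ) (hδ : 0 < δ) :
    Summable fun n : ℤ => Real.exp (-(δ * |(n : ℝ) + α|)) := by
  have h1 : Summable fun n : ℕ => Real.exp (-(δ * |((n : ℤ) : ℝ)|)) := by
    have := Real.summable_exp_nat_mul_iff.mpr (show -δ < 0 by linarith)
    refine this.congr fun n => ?_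
    simp
    ring
  have h2 : Summable fun n : ℤ => Real.exp (-(δ * |(n : ℝ)|)) := by
    refine Summable.of_nat_of_neg h1 ?_
    simpa using h1
  refine Summable.of_nonneg_of_le (fun _ => (Real.exp_pos _).le) (fun n => ?_)
    (h2.mul_left (Real.exp (δ * |α|)))
  rw [← Real.exp_add, Real.exp_le_exp]
  have := abs_sub ((n : ℝ) + α) α
  rw [add_sub_cancel_right] at this
  nlinarith

/-- The series `∑ b_n z ^ (n + α)` on the universal cover. -/
def laurent (α : ℝ) (b : ℤ → ℂ) (p : ℝ × ℝ) : ℂ :=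
  ∑' n : ℤ, b n * Complex.exp ((n + α) * (Real.log p.1 + p.2 * Complex.I))

lemma term_bound {q α : ℝ} {b : ℤ → ℂ} (hq : 0 < q) (h1 : Summable fun n => ‖b n‖ ^ 2)
    (h2 : Summable fun n : ℤ => (‖b n‖ * q ^ (n + α : ℝ)) ^ 2) {x y : ℝ} (hx : Real.log q < x)
    (hy : y < 0) :
    ∃ u : ℤ → ℝ, Summable u ∧ ∀ n (w : ℂ), x ≤ w.re → w.re ≤ y →
      ‖b n * Complex.exp ((n + α) * w)‖ ≤ u n := by
  set δ := min (-y) (x - Real.log q)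
  have hδ : 0 < δ := lt_min (by linarith) (by linarith)
  obtain ⟨A, hA0, hA⟩ : ∃ A : ℝ, 0 ≤ A ∧ ∀ n, ‖b n‖ ≤ A ∧ ‖b n‖ * q ^ (n + α : ℝ) ≤ A := by
    refine ⟨Real.sqrt (∑' n, ‖b n‖ ^ 2) + Real.sqrt (∑' n : ℤ, (‖b n‖ * q ^ (n + α : ℝ)) ^ 2),
      by positivity, fun n => ⟨?_, ?_⟩⟩
    · have := Real.le_sqrt_of_sq_le (h1.le_tsum n (fun _ _ => by positivity))
      linarith [Real.sqrt_nonneg (∑' n : ℤ, (‖b n‖ * q ^ (n + α : ℝ)) ^ 2)]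
    · have := Real.le_sqrt_of_sq_le (h2.le_tsum n (fun _ _ => by positivity))
      linarith [Real.sqrt_nonneg (∑' n : ℤ, ‖b n‖ ^ 2)]
  refine ⟨_, (summable_exp_abs α δ hδ).mul_left A, fun n w hw1 hw2 => ?_⟩
  have e : ((n : ℂ) + α) * w = (((n : ℝ) + α : ℝ) : ℂ) * w := by push_cast; ring
  rw [norm_mul, Complex.norm_exp, e, Complex.re_ofReal_mul]
  rcases le_or_gt 0 ((n : ℝ) + α) with hn | hn
  · rw [abs_of_nonneg hn]
    refine mul_le_mul (hA n).1 ?_ (Real.exp_pos _).le hA0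
    rw [Real.exp_le_exp]
    have : δ ≤ -y := min_le_left _ _
    nlinarith
  · rw [abs_of_neg hn]
    have : Real.exp (((n : ℝ) + α) * w.re) =
        q ^ (n + α : ℝ) * Real.exp (((n : ℝ) + α) * (w.re - Real.log q)) := by
      rw [Real.rpow_def_of_pos hq, ← Real.exp_add]
      congr 1; ring
    rw [this, ← mul_assoc]
    refine mul_le_mul (hA n).2 ?_ (Real.exp_pos _).le hA0
    rw [Real.exp_le_exp]
    have : δ ≤ x - Real.log q := min_le_right _ _
    nlinarith

lemma laurent_automorphic {q α : ℝ} {b : ℤ → ℂ} (hq : 0 < q) (h1 : Summable fun n => ‖b n‖ ^ 2)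
    (h2 : Summable fun n : ℤ => (‖b n‖ * q ^ (n + α : ℝ)) ^ 2) :
    IsAutomorphic q α (laurent α b) where
  analytic := by
    intro w0 hw0
    have hl : Real.log q < w0.re := (Real.log_lt_iff_lt_exp hq).mpr hw0.1
    have hr : w0.re < 0 := Real.exp_lt_one_iff.mp hw0.2
    obtain ⟨x, hx1, hx2⟩ := exists_between hl
    obtain ⟨y, hy1, hy2⟩ := exists_between hr
    obtain ⟨u, hu, hb⟩ := term_bound hq h1 h2 hx1 hy2
    have hU : IsOpen {w : ℂ | x < w.re ∧ w.re < y} :=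
      (isOpen_lt continuous_const Complex.continuous_re).inter
        (isOpen_lt Complex.continuous_re continuous_const)
    have hd := Complex.differentiableOn_tsum_of_summable_norm
      (F := fun (n : ℤ) (w : ℂ) => b n * Complex.exp ((n + α) * w)) hu (U := {w : ℂ | x < w.re ∧ w.re < y})
      (fun n => (by fun_prop : Differentiable ℂ fun w : ℂ =>
        b n * Complex.exp ((n + α) * w)).differentiableOn) hU
      (fun n w hw => hb n w hw.1.le hw.2.le)
    have := (hd.differentiableAt (hU.mem_nhds ⟨hx2, hy1⟩)).differentiableWithinAt
      (s := {w : ℂ | q < Real.exp w.re ∧ Real.exp w.re < 1})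
    refine this.congr (fun w _ => ?_) ?_ <;> simp [laurent, Complex.re_add_im]
  index := by
    intro r t _ _
    rw [laurent, laurent, ← tsum_mul_left]
    congr 1
    ext n
    rw [mul_left_comm, ← Complex.exp_add]
    congr 1
    rw [Complex.exp_eq_exp_iff_exists_int]
    exact ⟨n, by push_cast; ring⟩

lemma integral_exp_int (k : ℤ) :
    ∫ t : ℝ, Complex.exp (k * t * Complex.I) ∂angleMeasure = if k = 0 then (2 * Real.pi : ℂ) else 0 := by
  rw [← intervalIntegral.integral_of_le Real.two_pi_pos.le]
  split_ifs with h
  · simp [h]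
  · have hk : (k : ℂ) * Complex.I ≠ 0 := by
      simp [h, Complex.I_ne_zero]
    have := integral_exp_mul_complex (a := 0) (b := 2 * Real.pi) hk
    rw [show (fun t : ℝ => Complex.exp (k * t * Complex.I)) =
      fun t : ℝ => Complex.exp (k * Complex.I * t) by ext t; congr 1; ring, this]
    have e : (k : ℂ) * Complex.I * ((2 * Real.pi : ℝ) : ℂ) = k * (2 * Real.pi * Complex.I) := by
      push_cast; ring
    rw [e, Complex.exp_int_mul_two_pi_mul_I]
    simp

lemma coef_laurent {q α : ℝ} {b : ℤ → ℂ} (hq : 0 < q) (h1 : Summable fun n => ‖b n‖ ^ 2)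
    (h2 : Summable fun n : ℤ => (‖b n‖ * q ^ (n + α : ℝ)) ^ 2) {r : ℝ} (hr : r ∈ Ioo q 1) (n : ℤ) :
    coef α (fun t => laurent α b (r, t)) n = ((r ^ (n + α : ℝ) : ℝ) : ℂ) * b n := by
  have hr0 := hq.trans hr.1
  obtain ⟨u, hu, hb⟩ := term_bound hq h1 h2 (x := Real.log r) (y := Real.log r)
    (Real.log_lt_log hq hr.1) (Real.log_neg hr0 hr.2)
  set c : ℤ → ℂ := fun k => b k * ((r ^ (k + α : ℝ) : ℝ) : ℂ) with hc
  have hcu : ∀ k, ‖c k‖ ≤ u k := by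
    intro k
    have := hb k (Real.log r) (by simp) (by simp)
    refine le_trans (le_of_eq ?_) this
    rw [hc, norm_mul, norm_mul]
    congr 2
    rw [Real.rpow_def_of_pos hr0]
    push_cast
    congr 1
    ring
  have hterm : ∀ k : ℤ, ∀ t : ℝ, Complex.exp (-((n + α) * t * Complex.I)) *
      (b k * Complex.exp ((k + α) * (Real.log r + t * Complex.I))) =
      c k * Complex.exp (((k - n : ℤ) : ℂ) * t * Complex.I) := by
    intro k t
    simp only [hc]
    rw [Real.rpow_def_of_pos hr0, mul_left_comm, ← Complex.exp_add, mul_assoc (b k), Complex.ofReal_exp,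
      ← Complex.exp_add]
    congr 2
    push_cast
    ring
  have hnorm : ∀ k : ℤ, ∀ t : ℝ, ‖c k * Complex.exp (((k - n : ℤ) : ℂ) * t * Complex.I)‖ = ‖c k‖ := by
    intro k t
    rw [norm_mul, show ((k - n : ℤ) : ℂ) * t * Complex.I = (((k - n : ℤ) * t : ℝ) : ℂ) * Complex.I by
      push_cast; ring, Complex.norm_exp_ofReal_mul_I, mul_one]
  rw [coef_eq]
  have hint : ∀ k : ℤ, Integrable
      (fun t : ℝ => c k * Complex.exp (((k - n : ℤ) : ℂ) * t * Complex.I)) angleMeasure := by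
    intro k
    refine Integrable.of_bound (Continuous.aestronglyMeasurable (by fun_prop)) ‖c k‖ ?_
    exact Eventually.of_forall fun t => (hnorm k t).le
  have hs := hasSum_integral_of_summable_integral_norm hint (by
    simp only [hnorm, integral_const, smul_eq_mul]
    exact (Summable.of_nonneg_of_le (fun _ => norm_nonneg _) hcu hu).mul_left _)
  have e : ∫ t, Complex.exp (-((n + α) * t * Complex.I)) * laurent α b (r, t) ∂angleMeasure =
      ∫ t, ∑' k : ℤ, c k * Complex.exp (((k - n : ℤ) : ℂ) * t * Complex.I) ∂angleMeasure := by
    refine integral_congr_ae (Eventually.of_forall fun t => ?_)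
    simp only [laurent, ← tsum_mul_left, hterm]
  rw [e, ← hs.tsum_eq]
  simp only [integral_const_mul, integral_exp_int, sub_eq_zero]
  rw [tsum_eq_single n (fun k hk => by simp [hk])]
  have : (Real.pi : ℂ) ≠ 0 := by exact_mod_cast Real.pi_ne_zero
  simp [hc]
  field_simp

lemma memLp_twist (α : ℝ) {f : ℝ → ℂ} (hf : MemLp f 2 angleMeasure) : MemLp (twist α f) 2 angleMeasure :=
  memLp_exp_mul α hf

lemma hasSum_coef (α : ℝ) {f : ℝ → ℂ} (hf : MemLp f 2 angleMeasure) :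
    HasSum (fun n => ‖coef α f n‖ ^ 2) ((2 * Real.pi)⁻¹ * ∫ t, ‖f t‖ ^ 2 ∂angleMeasure) := by
  have := hasSum_sq_fourierCoeffOn (a := 0) (b := 2 * Real.pi) Real.two_pi_pos (memLp_twist α hf)
  simp only [norm_twist] at this
  rwa [sub_zero, intervalIntegral.integral_of_le Real.two_pi_pos.le] at this

lemma coef_sub (α : ℝ) {f g : ℝ → ℂ} (hf : MemLp f 2 angleMeasure) (hg : MemLp g 2 angleMeasure) (n : ℤ) :
    coef α (fun t => f t - g t) n = coef α f n - coef α g n := by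
  have e : ((n:ℂ) + α) = ((n + α : ℝ) : ℂ) := by push_cast; ring
  rw [coef_eq, coef_eq, coef_eq, ← smul_sub]
  simp only [e]
  rw [← integral_sub ((memLp_exp_mul _ hf).integrable (by norm_num))
    ((memLp_exp_mul _ hg).integrable (by norm_num))]
  simp only [mul_sub]

lemma eLpNorm_tendsto_zero {ι : Type*} {l : Filter ι} (α : ℝ) {f : ι → ℝ → ℂ}
    (hf : ∀ᶠ i in l, MemLp (f i) 2 angleMeasure)
    (h : Tendsto (fun i => ∑' n, ‖coef α (f i) n‖ ^ 2) l (𝓝 0)) :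
    Tendsto (fun i => eLpNorm (f i) 2 angleMeasure) l (𝓝 0) := by
  have h2 : Tendsto (fun i => ENNReal.ofReal
      (((2 * Real.pi) * ∑' n, ‖coef α (f i) n‖ ^ 2) ^ (2 : ℝ)⁻¹)) l (𝓝 0) := by
    have := ((h.const_mul (2 * Real.pi)).rpow_const (p := (2 : ℝ)⁻¹) (Or.inr (by norm_num)))
    simpa using ENNReal.tendsto_ofReal this
  refine h2.congr' ?_
  filter_upwards [hf] with i hi
  rw [hi.eLpNorm_eq_integral_rpow_norm (by norm_num) (by norm_num), (hasSum_coef α hi).tsum_eq,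
    mul_inv_cancel_left₀ Real.two_pi_pos.ne']
  simp

lemma laurent_tendsto {q α : ℝ} {b : ℤ → ℂ} (hq : 0 < q) (h1 : Summable fun n => ‖b n‖ ^ 2)
    (h2 : Summable fun n : ℤ => (‖b n‖ * q ^ (n + α : ℝ)) ^ 2) {s : ℝ} (hs : s ∈ Icc q 1)
    {g : ℝ → ℂ} (hg : MemLp g 2 angleMeasure) (hgc : ∀ n, coef α g n = ((s ^ (n + α : ℝ) : ℝ) : ℂ) * b n) :
    Tendsto (fun r : ℝ => eLpNorm (fun t => laurent α b (r, t) - g t) 2 angleMeasure) (𝓝[Ioo q 1] s) (𝓝 0) := by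
  have hF := laurent_automorphic hq h1 h2
  have hmem : ∀ᶠ r in 𝓝[Ioo q 1] s, r ∈ Ioo q 1 := eventually_mem_nhdsWithin
  refine eLpNorm_tendsto_zero α ?_ ?_
  · filter_upwards [hmem] with r hr using (memLp_slice hF hq hr.1 hr.2).sub hg
  have hpow : ∀ x : ℝ, ∀ r ∈ Icc q 1, r ^ x ≤ 1 + q ^ x := by
    intro x r hr
    have hr0 := hq.trans_le hr.1
    rcases le_or_gt 0 x with hx | hx
    · have := Real.rpow_le_one hr0.le hr.2 hx
      have := Real.rpow_nonneg hq.le x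
      linarith
    · have := Real.rpow_le_rpow_of_nonpos hq hr.1 hx.le
      linarith
  have hpow0 : ∀ x : ℝ, ∀ r ∈ Icc q 1, 0 ≤ r ^ x := fun x r hr =>
    Real.rpow_nonneg (hq.le.trans hr.1) x
  have key : Tendsto (fun r : ℝ => ∑' n : ℤ,
      ‖(((r ^ (n + α : ℝ) : ℝ) : ℂ) - ((s ^ (n + α : ℝ) : ℝ) : ℂ)) * b n‖ ^ 2)
      (𝓝[Ioo q 1] s) (𝓝 (∑' n : ℤ, (0 : ℝ))) := by
    refine tendsto_tsum_of_dominated_convergence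
      (bound := fun n : ℤ => 2 * (‖b n‖ ^ 2 + (‖b n‖ * q ^ (n + α : ℝ)) ^ 2))
      ((h1.add h2).mul_left 2) ?_ ?_
    · intro n
      have hc : ContinuousAt (fun r : ℝ => r ^ (n + α : ℝ)) s :=
        Real.continuousAt_rpow_const _ _ (Or.inl (hq.trans_le hs.1).ne')
      have h3 : ContinuousAt (fun r : ℝ =>
          ‖(((r ^ (n + α : ℝ) : ℝ) : ℂ) - ((s ^ (n + α : ℝ) : ℝ) : ℂ)) * b n‖ ^ 2) s := by
        have := Complex.continuous_ofReal.continuousAt.comp hc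
        exact (((this.sub continuousAt_const).mul continuousAt_const).norm).pow 2
      have := h3.tendsto.mono_left (nhdsWithin_le_nhds (s := Ioo q 1))
      simpa using this
    · filter_upwards [hmem] with r hr n
      have hr' := Ioo_subset_Icc_self hr
      rw [Real.norm_of_nonneg (by positivity), norm_mul, ← Complex.ofReal_sub, Complex.norm_real,
        Real.norm_eq_abs]
      set x : ℝ := n + α
      have habs : |r ^ x - s ^ x| ≤ 1 + q ^ x := by
        rw [abs_le]
        constructor <;> linarith [hpow x r hr', hpow x s hs, hpow0 x r hr', hpow0 x s hs]
      calc (|r ^ x - s ^ x| * ‖b n‖) ^ 2 ≤ ((1 + q ^ x) * ‖b n‖) ^ 2 := by gcongr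
        _ ≤ _ := by nlinarith [sq_nonneg (‖b n‖ - ‖b n‖ * q ^ x)]
  rw [tsum_zero] at key
  refine key.congr' ?_
  filter_upwards [hmem] with r hr
  congr 1
  ext n
  rw [coef_sub α (memLp_slice hF hq hr.1 hr.2) hg, coef_laurent hq h1 h2 hr, hgc, sub_mul]

lemma circleMeasure_one_le (q : ℝ) : circleMeasure 1 ≤ boundaryMeasure q :=
  Measure.le_add_right le_rfl

lemma circleMeasure_le (q : ℝ) : circleMeasure q ≤ boundaryMeasure q :=
  Measure.le_add_left le_rfl

lemma ae_circle {q s : ℝ} (hs : circleMeasure s ≤ boundaryMeasure q) {p : ℂ → Prop}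
    (h : ∀ᵐ z ∂boundaryMeasure q, p z) : ∀ᵐ t ∂angleMeasure, p (circleMap 0 s t) :=
  ae_of_ae_map (continuous_circleMap 0 s).aemeasurable (ae_mono hs h)

lemma memLp_circle {q s : ℝ} (hs : circleMeasure s ≤ boundaryMeasure q)
    (u : Lp ℂ 2 (boundaryMeasure q)) : MemLp (fun t => u (circleMap 0 s t)) 2 angleMeasure :=
  ((Lp.memLp u).mono_measure hs).comp_of_map (continuous_circleMap 0 s).aemeasurable

lemma HasBoundaryValue.congr {q s : ℝ} (hs : circleMeasure s ≤ boundaryMeasure q)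
    {F : ℝ × ℝ → ℂ} {l : Filter ℝ} {u v : ℂ → ℂ} (h : HasBoundaryValue F s l u)
    (huv : u =ᵐ[boundaryMeasure q] v) : HasBoundaryValue F s l v := by
  refine Tendsto.congr (fun r => ?_) h
  refine eLpNorm_congr_ae ?_
  filter_upwards [ae_circle hs huv] with t ht
  simp [ht]

lemma HasBoundaryValue.add {q s : ℝ} (hs : circleMeasure s ≤ boundaryMeasure q)
    {F G : ℝ × ℝ → ℂ} {l : Filter ℝ} {u v : Lp ℂ 2 (boundaryMeasure q)}
    (hF : HasBoundaryValue F s l u) (hG : HasBoundaryValue G s l v)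
    (hFm : ∀ᶠ r in l, MemLp (fun t => F (r, t)) 2 angleMeasure)
    (hGm : ∀ᶠ r in l, MemLp (fun t => G (r, t)) 2 angleMeasure) :
    HasBoundaryValue (F + G) s l (u + v : Lp ℂ 2 (boundaryMeasure q)) := by
  refine HasBoundaryValue.congr hs (u := u + v) ?_ (Lp.coeFn_add u v).symm
  have h := Tendsto.add hF hG
  rw [add_zero] at h
  refine tendsto_of_tendsto_of_tendsto_of_le_of_le' tendsto_const_nhds h
    (Eventually.of_forall fun _ => zero_le) ?_
  filter_upwards [hFm, hGm] with r h1 h2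
  refine le_trans (le_of_eq ?_) (eLpNorm_add_le (h1.sub (memLp_circle hs u)).1
    (h2.sub (memLp_circle hs v)).1 (by norm_num))
  congr 1
  ext t
  simp
  ring

lemma HasBoundaryValue.smul {q s : ℝ} (hs : circleMeasure s ≤ boundaryMeasure q)
    {F : ℝ × ℝ → ℂ} {l : Filter ℝ} {u : Lp ℂ 2 (boundaryMeasure q)} (c : ℂ)
    (hF : HasBoundaryValue F s l u) :
    HasBoundaryValue (c • F) s l (c • u : Lp ℂ 2 (boundaryMeasure q)) := by
  refine HasBoundaryValue.congr hs (u := c • u) ?_ (Lp.coeFn_smul c u).symm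
  have h := ENNReal.Tendsto.const_mul (a := ‖c‖ₑ) hF (Or.inr (by simp))
  rw [mul_zero] at h
  refine h.congr fun r => ?_
  rw [← eLpNorm_const_smul]
  congr 1
  ext t
  simp
  ring

lemma eventually_slice_one {q α : ℝ} {F : ℝ × ℝ → ℂ} (hF : IsAutomorphic q α F) (hq : 0 < q)
    (hq1 : q < 1) : ∀ᶠ r in 𝓝[<] (1 : ℝ), MemLp (fun t => F (r, t)) 2 angleMeasure := by
  filter_upwards [Ioo_mem_nhdsLT hq1] with r hr using memLp_slice hF hq hr.1 hr.2

lemma eventually_slice {q α : ℝ} {F : ℝ × ℝ → ℂ} (hF : IsAutomorphic q α F) (hq : 0 < q)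
    (hq1 : q < 1) : ∀ᶠ r in 𝓝[>] q, MemLp (fun t => F (r, t)) 2 angleMeasure := by
  filter_upwards [Ioo_mem_nhdsGT hq1] with r hr using memLp_slice hF hq hr.1 hr.2

/-- The Hardy space `H²_α` of the annulus, as a subspace of `L²(B)`: the boundary values of the
analytic modulus automorphic functions `F` of index `α` having square integrable boundary values
on both boundary circles (taken in the `L²` sense). A multivalued function is restricted to `B` by
means of the branch `0 < t ≤ 2π`, the same for all members of the space. -/
def hardySpace (q α : ℝ) (hq0 : 0 < q) (hq1 : q < 1) :
    Submodule ℂ (Lp ℂ 2 (boundaryMeasure q)) where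
  carrier := {u | ∃ F : ℝ × ℝ → ℂ, IsAutomorphic q α F ∧
    HasBoundaryValue F 1 (𝓝[<] 1) u ∧ HasBoundaryValue F q (𝓝[>] q) u}
  zero_mem' := by
    refine ⟨0, ⟨differentiableOn_const 0, fun _ _ _ _ => by simp⟩, ?_, ?_⟩
    · refine HasBoundaryValue.congr (circleMeasure_one_le q) (u := 0) ?_ (Lp.coeFn_zero _ _ _).symm
      simp [HasBoundaryValue]
    · refine HasBoundaryValue.congr (circleMeasure_le q) (u := 0) ?_ (Lp.coeFn_zero _ _ _).symm
      simp [HasBoundaryValue]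
  add_mem' := by
    rintro u v ⟨F, hF, hF1, hF2⟩ ⟨G, hG, hG1, hG2⟩
    refine ⟨F + G, ⟨hF.analytic.add hG.analytic, fun r t h1 h2 => ?_⟩,
      hF1.add (circleMeasure_one_le q) hG1 (eventually_slice_one hF hq0 hq1)
        (eventually_slice_one hG hq0 hq1),
      hF2.add (circleMeasure_le q) hG2 (eventually_slice hF hq0 hq1)
        (eventually_slice hG hq0 hq1)⟩
    simp only [Pi.add_apply, hF.index r t h1 h2, hG.index r t h1 h2, mul_add]
  smul_mem' := by
    rintro c u ⟨F, hF, hF1, hF2⟩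
    refine ⟨c • F, ⟨hF.analytic.const_smul c, fun r t h1 h2 => ?_⟩,
      hF1.smul (circleMeasure_one_le q) c, hF2.smul (circleMeasure_le q) c⟩
    simp only [Pi.smul_apply, hF.index r t h1 h2, smul_eq_mul, mul_left_comm]

lemma mem_hardySpace_iff {q α : ℝ} (hq0 : 0 < q) (hq1 : q < 1) (u : Lp ℂ 2 (boundaryMeasure q)) :
    u ∈ hardySpace q α hq0 hq1 ↔ ∀ n : ℤ, coef α (fun t => u (circleMap 0 q t)) n =
      ((q ^ (n + α : ℝ) : ℝ) : ℂ) * coef α (fun t => u (circleMap 0 1 t)) n := by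
  constructor
  · rintro ⟨F, hF, hF1, hF2⟩ n
    have l1 := coef_tendsto α (eventually_slice_one hF hq0 hq1)
      (memLp_circle (circleMeasure_one_le q) u) hF1 n
    have l2 := coef_tendsto α (eventually_slice hF hq0 hq1)
      (memLp_circle (circleMeasure_le q) u) hF2 n
    have p : ∀ s ∈ Ioo q 1, ((s ^ (n + α : ℝ) : ℝ) : ℂ) * coef α (fun t => u (circleMap 0 1 t)) n =
        coef α (fun t => F (s, t)) n := by
      intro s hs
      have c1 : Tendsto (fun r : ℝ => ((r ^ (n + α : ℝ) : ℝ) : ℂ)) (𝓝[<] 1) (𝓝 1) := by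
        have : ContinuousAt (fun r : ℝ => ((r ^ (n + α : ℝ) : ℝ) : ℂ)) 1 :=
          Complex.continuous_ofReal.continuousAt.comp
            (Real.continuousAt_rpow_const _ _ (Or.inl one_ne_zero))
        simpa using this.tendsto.mono_left (nhdsWithin_le_nhds (s := Iio 1))
      have a := l1.const_mul (((s ^ (n + α : ℝ) : ℝ) : ℂ))
      have b := c1.mul_const (coef α (fun t => F (s, t)) n)
      rw [one_mul] at b
      refine tendsto_nhds_unique_of_eventuallyEq a b ?_
      filter_upwards [Ioo_mem_nhdsLT hq1] with r hr using coef_slice hF hq0 n hr hs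
    have c2 : Tendsto (fun r : ℝ => ((r ^ (n + α : ℝ) : ℝ) : ℂ)) (𝓝[>] q)
        (𝓝 ((q ^ (n + α : ℝ) : ℝ) : ℂ)) := by
      have : ContinuousAt (fun r : ℝ => ((r ^ (n + α : ℝ) : ℝ) : ℂ)) q :=
        Complex.continuous_ofReal.continuousAt.comp
          (Real.continuousAt_rpow_const _ _ (Or.inl hq0.ne'))
      exact this.tendsto.mono_left (nhdsWithin_le_nhds (s := Ioi q))
    have a := c2.mul_const (coef α (fun t => u (circleMap 0 1 t)) n)
    refine tendsto_nhds_unique_of_eventuallyEq l2 a ?_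
    filter_upwards [Ioo_mem_nhdsGT hq1] with r hr using (p r hr).symm
  · intro h
    set b := coef α (fun t => u (circleMap 0 1 t)) with hb
    have m1 := memLp_circle (circleMeasure_one_le q) u
    have m2 := memLp_circle (circleMeasure_le q) u
    have h1 : Summable fun n => ‖b n‖ ^ 2 := (hasSum_coef α m1).summable
    have h2 : Summable fun n : ℤ => (‖b n‖ * q ^ (n + α : ℝ)) ^ 2 := by
      refine (hasSum_coef α m2).summable.congr fun n => ?_
      rw [h, norm_mul, Complex.norm_real, Real.norm_of_nonneg (Real.rpow_nonneg hq0.le _), mul_comm]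
    refine ⟨laurent α b, laurent_automorphic hq0 h1 h2, ?_, ?_⟩
    · have := laurent_tendsto hq0 h1 h2 (s := 1) ⟨hq1.le, le_rfl⟩ m1 (by simp [hb])
      rwa [nhdsWithin_Ioo_eq_nhdsLT hq1] at this
    · have := laurent_tendsto hq0 h1 h2 (s := q) ⟨le_rfl, hq1.le⟩ m2 h
      rwa [nhdsWithin_Ioo_eq_nhdsGT hq1] at this

lemma continuous_coef_circle {q s : ℝ} (hs : circleMeasure s ≤ boundaryMeasure q) (α : ℝ) (n : ℤ) :
    Continuous fun u : Lp ℂ 2 (boundaryMeasure q) => coef α (fun t => u (circleMap 0 s t)) n := by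
  rw [continuous_iff_continuousAt]
  intro v
  refine coef_tendsto α (Eventually.of_forall fun u => memLp_circle hs u) (memLp_circle hs v) ?_ n
  have h := (Lp.tendsto_Lp_iff_tendsto_eLpNorm' (fi := 𝓝 v)
    (fun u : Lp ℂ 2 (boundaryMeasure q) => u) v).mp tendsto_id
  refine tendsto_of_tendsto_of_tendsto_of_le_of_le tendsto_const_nhds h
    (fun _ => zero_le) fun u => ?_
  refine le_trans (le_of_eq ?_) (eLpNorm_mono_measure _ hs)
  have hm := ((Lp.memLp u).sub (Lp.memLp v)).1.mono_measure hs
  rw [circleMeasure, eLpNorm_map_measure hm (continuous_circleMap 0 s).aemeasurable]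
  rfl

/-- `H²_α` is closed in `L²(B)`, so that the orthogonal projection onto it exists. -/
lemma isClosed_hardySpace (q α : ℝ) (hq0 : 0 < q) (hq1 : q < 1) :
    IsClosed (hardySpace q α hq0 hq1 : Set (Lp ℂ 2 (boundaryMeasure q))) := by
  have : (hardySpace q α hq0 hq1 : Set (Lp ℂ 2 (boundaryMeasure q))) =
      ⋂ n : ℤ, {u | coef α (fun t => u (circleMap 0 q t)) n =
      ((q ^ (n + α : ℝ) : ℝ) : ℂ) * coef α (fun t => u (circleMap 0 1 t)) n} := by
    ext u
    simp [mem_hardySpace_iff]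
  rw [this]
  exact isClosed_iInter fun n => isClosed_eq (continuous_coef_circle (circleMeasure_le q) α n)
    (continuous_const.mul (continuous_coef_circle (circleMeasure_one_le q) α n))

instance completeSpace_hardySpace (q α : ℝ) (hq0 : 0 < q) (hq1 : q < 1) :
    CompleteSpace (hardySpace q α hq0 hq1) :=
  (isClosed_hardySpace q α hq0 hq1).completeSpace_coe

/-- Multiplication by `φ ∈ L^∞(B)` on `L²(B)`. -/
def multiplication (q : ℝ) (φ : ℂ → ℝ) (hφ : MemLp φ ∞ (boundaryMeasure q)) :
    Lp ℂ 2 (boundaryMeasure q) →L[ℂ] Lp ℂ 2 (boundaryMeasure q) :=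
  (ContinuousLinearMap.mul ℂ ℂ).holderL (boundaryMeasure q) ∞ 2 2 (hφ.ofReal (K := ℂ)).toLp

lemma multiplication_ae (q : ℝ) (φ : ℂ → ℝ) (hφ : MemLp φ ∞ (boundaryMeasure q))
    (u : Lp ℂ 2 (boundaryMeasure q)) :
    multiplication q φ hφ u =ᵐ[boundaryMeasure q] fun z => (φ z : ℂ) * u z := by
  refine (ContinuousLinearMap.coeFn_holder _ _ _).trans ?_
  filter_upwards [(hφ.ofReal (K := ℂ)).coeFn_toLp] with z hz
  rw [hz]
  simp

/-- The Toeplitz operator `T f = P (φ f)` on `H²_α`, where `P` is the orthogonal projection of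
`L²(B)` onto `H²_α`. -/
def toeplitz (q α : ℝ) (hq0 : 0 < q) (hq1 : q < 1) (φ : ℂ → ℝ)
    (hφ : MemLp φ ∞ (boundaryMeasure q)) :
    hardySpace q α hq0 hq1 →L[ℂ] hardySpace q α hq0 hq1 :=
  (hardySpace q α hq0 hq1).orthogonalProjectionOnto ∘L multiplication q φ hφ ∘L
    (hardySpace q α hq0 hq1).subtypeL

/-- `∫ f dμ = -∞` for an extended real valued `f`: the integral of the positive part is finite and
that of the negative part is infinite. -/
def IntegralEqBot {X : Type*} [MeasurableSpace X] (f : X → EReal) (μ : Measure X) : Prop :=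
  ∫⁻ x, (f x).toENNReal ∂μ ≠ ∞ ∧ ∫⁻ x, (-f x).toENNReal ∂μ = ∞

/-- `∫_B log |φ - c| dμ = -∞`, where `log 0 = -∞`. -/
def LogIntegralEqBot (q : ℝ) (φ : ℂ → ℝ) (c : ℝ) : Prop :=
  IntegralEqBot (fun z => ENNReal.log ‖φ z - c‖ₑ) (boundaryMeasure q)

end AnnulusToeplitz

end

namespace AnnulusToeplitz

/-! Let `m < l < M`. Then `φ - l` is bounded away from zero and has constant, opposite signs on the
two circles. A nonzero `u ∈ H²_α` is an eigenvector for `l` exactly when `(φ - l) u` is orthogonal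
to `H²_α`. Suppose `u` comes from a zero-free function with `|u|² = 1 / |φ - l|` on `B`. Then `(φ -
l) ū = ±1 / u`, with opposite signs on the two circles, so pairing with `w ∈ H²_α` gives, up to
sign, the integral of `w / u` over `B_1` minus that over `B_q`. Since `w / u` is single valued and
analytic in the annulus, its zeroth Laurent coefficient is the same on every circle, and the pairing
vanishes (`hasEigenvalue_toeplitz`).

The existence of such a `u` with the prescribed index is the only obstruction. The harmonic function
with boundary values `-(1/2) log |φ - l|` need not have a single valued conjugate. Subtracting `κ
log r`, with `κ` chosen so that the two boundary means become equal, leaves the real part of a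
single valued analytic `H` (`exists_automorphic_re_eq`). With `w = log r + i t`, the function `exp
(H + κ w)` has the required modulus and is multiplied by `exp (2πiκ)` over one period, so its index
is `α` when `κ ∈ α + ℤ` (`exists_outer`). Boundedness of `Re H` keeps `u` and `1 / u` bounded, so
that `L²` boundary values survive multiplication by either.

Thus `l` is an eigenvalue whenever `D(l)`, the integral of `log |φ - l|` over `B_1` minus that over
`B_q`, lies in the progression `4π log q (α + ℤ)`. The function `D` is continuous on `(m, M)`.
Divergence of the logarithmic integral at `M` or at `m` drives, by Fatou's lemma, one of the two
integrals to `-∞` at that endpoint while the other stays bounded below there. Hence `D` is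
unbounded, its range contains a half-line by the intermediate value theorem, and it meets the
progression infinitely often (`infinite_setOf_integral_log_sub_eq`). -/

/-! ### Fourier coefficients on one circle. -/

lemma ae_eq_of_coef_eq {α : ℝ} {f g : ℝ → ℂ} (hf : MemLp f 2 angleMeasure)
    (hg : MemLp g 2 angleMeasure) (h : ∀ n, coef α f n = coef α g n) :
    f =ᵐ[angleMeasure] g := by
  have hs := hasSum_coef α (hf.sub hg)
  have h0 : ∀ n, ‖coef α (f - g) n‖ ^ 2 = 0 := by
    intro n
    have := coef_sub α hf hg n
    rw [h, sub_self] at this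
    have e : coef α (f - g) n = 0 := this
    simp [e]
  simp only [h0] at hs
  have h1 := hs.unique hasSum_zero
  have h2 : ∫ t, ‖(f - g) t‖ ^ 2 ∂angleMeasure = 0 := by
    have := Real.pi_pos
    rcases mul_eq_zero.mp h1 with h | h
    · exact absurd h (by positivity)
    · exact h
  rw [integral_eq_zero_iff_of_nonneg (fun t => by positivity)
    ((hf.sub hg).integrable_norm_pow (by norm_num))] at h2
  filter_upwards [h2] with t ht
  have : ‖(f - g) t‖ = 0 := by simpa using ht
  simpa [sub_eq_zero] using this

/-- Riesz–Fischer. It produces the boundary functions of a Laurent series from its coefficients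
alone, without pointwise limits. -/
lemma exists_memLp_coef_eq {c : ℤ → ℂ} (hc : Summable fun n => ‖c n‖ ^ 2) :
    ∃ g : ℝ → ℂ, MemLp g 2 angleMeasure ∧ ∀ n, coef 0 g n = c n := by
  have : Fact (0 < 2 * Real.pi) := ⟨Real.two_pi_pos⟩
  have hc' : Memℓp c 2 := by
    rw [memℓp_gen_iff (by norm_num)]
    simpa using hc
  set G := (fourierBasis (T := 2 * Real.pi)).repr.symm ⟨c, hc'⟩ with hG
  have hGc : ∀ n, fourierCoeff G n = c n := by
    intro n
    rw [← fourierBasis_repr, hG, LinearIsometryEquiv.apply_symm_apply]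
  have hGm : MemLp G 2 (volume : Measure (AddCircle (2 * Real.pi))) := by
    rw [AddCircle.volume_eq_smul_haarAddCircle]
    exact (Lp.memLp G).smul_measure (by finiteness)
  have hmp := AddCircle.measurePreserving_mk (2 * Real.pi) 0
  rw [zero_add] at hmp
  refine ⟨fun t => G (t : AddCircle (2 * Real.pi)), hGm.comp_measurePreserving hmp, fun n => ?_⟩
  rw [← hGc, coef_eq, fourierCoeff_eq_intervalIntegral G n 0, zero_add,
    intervalIntegral.integral_of_le Real.two_pi_pos.le]
  congr 2
  ext t
  rw [fourier_coe_apply, smul_eq_mul]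
  congr 2
  have : (Real.pi : ℂ) ≠ 0 := by exact_mod_cast Real.pi_ne_zero
  push_cast
  field_simp
  ring

lemma coef_conj (f : ℝ → ℂ) (n : ℤ) :
    coef 0 (fun t => (starRingEnd ℂ) (f t)) n = (starRingEnd ℂ) (coef 0 f (-n)) := by
  rw [coef_eq, coef_eq, Complex.real_smul, Complex.real_smul, map_mul, Complex.conj_ofReal,
    ← integral_conj]
  congr 2
  ext t
  rw [map_mul, ← Complex.exp_conj]
  simp

lemma coef_add {α : ℝ} {f g : ℝ → ℂ} (hf : MemLp f 2 angleMeasure) (hg : MemLp g 2 angleMeasure)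
    (n : ℤ) : coef α (fun t => f t + g t) n = coef α f n + coef α g n := by
  have := coef_sub α (hf.add hg) hg n
  simp only [Pi.add_apply, add_sub_cancel_right] at this
  rw [this]
  simp [Pi.add_def]

lemma norm_coef_le {v : ℝ → ℝ} {K : ℝ} (hK : ∀ᵐ t ∂angleMeasure, |v t| ≤ K) (n : ℤ) :
    ‖coef 0 (fun t => (v t : ℂ)) n‖ ≤ K := by
  rw [coef_eq, norm_smul, Real.norm_of_nonneg (by have := Real.pi_pos; positivity)]
  have h := norm_integral_le_of_norm_le_const (μ := angleMeasure) (C := K)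
    (f := fun t : ℝ => Complex.exp (-((n + (0 : ℝ)) * t * Complex.I)) * (v t : ℂ)) ?_
  · have e : angleMeasure.real univ = 2 * Real.pi := by
      simp [Measure.real, Real.pi_pos.le]
    rw [e] at h
    have := Real.pi_pos
    rw [one_div, inv_mul_le_iff₀ (by positivity)]
    linarith
  · filter_upwards [hK] with t ht
    rw [norm_mul, Complex.norm_real, show (-(((n : ℂ) + (0 : ℝ)) * t * Complex.I)) =
      ((-(n * t) : ℝ) : ℂ) * Complex.I by push_cast; ring, Complex.norm_exp_ofReal_mul_I, one_mul]
    exact ht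

/-! ### The Herglotz integral in the disc. -/

/-- The disc kernel `2 / (1 - ζ exp (-i s)) - 1`, whose real part is the Poisson kernel. -/
noncomputable def discKernel (ζ : ℂ) (s : ℝ) : ℂ := 2 / (1 - ζ * Complex.exp (-(s * Complex.I))) - 1

lemma norm_mul_exp_neg (ζ : ℂ) (s : ℝ) : ‖ζ * Complex.exp (-(s * Complex.I))‖ = ‖ζ‖ := by
  rw [norm_mul, show (-((s : ℂ) * Complex.I)) = ((-s : ℝ) : ℂ) * Complex.I by push_cast; ring,
    Complex.norm_exp_ofReal_mul_I, mul_one]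

/-- With `η = ζ exp (-i s)` the kernel is `(1 + η) / (1 - η)`, whose real part is `(1 - |η|²) / |1 -
η|²`. -/
lemma discKernel_re_nonneg {ζ : ℂ} (hζ : ‖ζ‖ < 1) (s : ℝ) : 0 ≤ (discKernel ζ s).re := by
  set η := ζ * Complex.exp (-(s * Complex.I)) with hη
  have h1 : ‖η‖ < 1 := by rwa [hη, norm_mul_exp_neg]
  have hne : 1 - η ≠ 0 := fun h => by
    rw [← sub_eq_zero.mp h] at h1
    simp at h1
  have e : discKernel ζ s = (1 + η) / (1 - η) := by
    rw [discKernel, ← hη]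
    field_simp
    ring
  rw [e, Complex.div_re]
  have h2 : Complex.normSq η < 1 := by
    rw [Complex.normSq_eq_norm_sq]
    nlinarith [norm_nonneg η]
  rw [← add_div]
  refine div_nonneg ?_ (Complex.normSq_nonneg _)
  rw [Complex.normSq_apply] at h2
  simp
  nlinarith

lemma continuous_discKernel {ζ : ℂ} (hζ : ‖ζ‖ < 1) : Continuous (discKernel ζ) := by
  unfold discKernel
  refine (Continuous.div continuous_const (by fun_prop) fun s h => ?_).sub continuous_const
  have h1 := norm_mul_exp_neg ζ s
  rw [← sub_eq_zero.mp h] at h1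
  simp at h1
  linarith

/-- Expand `1 / (1 - ζ exp (-i s))` in a geometric series and integrate termwise. The `-1` in the
kernel accounts for subtracting the zeroth coefficient from `2 * A`. -/
lemma hasSum_coef_mul_pow {v : ℝ → ℝ} {K : ℝ} (hv : AEStronglyMeasurable v angleMeasure)
    (hK : ∀ᵐ t ∂angleMeasure, |v t| ≤ K) {ζ : ℂ} (hζ : ‖ζ‖ < 1) :
    ∃ A : ℂ, HasSum (fun n : ℕ => coef 0 (fun t => (v t : ℂ)) n * ζ ^ n) A ∧
      2 * A - coef 0 (fun t => (v t : ℂ)) 0 =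
        (1 / (2 * Real.pi) : ℝ) • ∫ s, (v s : ℂ) * discKernel ζ s ∂angleMeasure := by
  have hvc : AEStronglyMeasurable (fun t => (v t : ℂ)) angleMeasure :=
    Complex.continuous_ofReal.comp_aestronglyMeasurable hv
  set c : ℝ := 1 / (2 * Real.pi)
  have hterm : ∀ n : ℕ, coef 0 (fun t => (v t : ℂ)) n * ζ ^ n =
      ∫ s, c • ((v s : ℂ) * (ζ * Complex.exp (-(s * Complex.I))) ^ n) ∂angleMeasure := by
    intro n
    rw [coef_eq, integral_smul, smul_mul_assoc, ← integral_mul_const]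
    congr 2
    ext s
    rw [mul_pow, ← Complex.exp_nat_mul]
    simp
    rw [show (n : ℂ) * (s * Complex.I) = n * s * Complex.I by ring]
    ring
  have hbd : ∀ n : ℕ, ∀ᵐ s ∂angleMeasure,
      ‖c • ((v s : ℂ) * (ζ * Complex.exp (-(s * Complex.I))) ^ n)‖ ≤ |c| * (K * ‖ζ‖ ^ n) := by
    intro n
    filter_upwards [hK] with s hs
    rw [norm_smul, norm_mul, norm_pow, norm_mul_exp_neg, Complex.norm_real, Real.norm_eq_abs,
      Real.norm_eq_abs]
    gcongr
  have hint : ∀ n : ℕ, Integrable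
      (fun s : ℝ => c • ((v s : ℂ) * (ζ * Complex.exp (-(s * Complex.I))) ^ n)) angleMeasure := by
    intro n
    refine Integrable.of_bound ?_ _ (hbd n)
    exact (hvc.mul (Continuous.aestronglyMeasurable (by fun_prop))).const_smul c
  have hs := hasSum_integral_of_summable_integral_norm hint (by
    have hsum := (((summable_geometric_of_lt_one (norm_nonneg ζ) hζ).mul_left K).mul_left |c|).mul_left
      (angleMeasure.real univ)
    refine Summable.of_nonneg_of_le (fun n => by positivity) (fun n => ?_) hsum
    refine (integral_mono_ae (hint n).norm (integrable_const _) (hbd n)).trans ?_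
    simp)
  simp only [← hterm] at hs
  refine ⟨_, hs, ?_⟩
  have h0 : coef 0 (fun t => (v t : ℂ)) 0 = ∫ s, c • (v s : ℂ) ∂angleMeasure := by
    have := hterm 0
    simpa using this
  have hgeo : ∀ s : ℝ, ∑' n : ℕ, c • ((v s : ℂ) * (ζ * Complex.exp (-(s * Complex.I))) ^ n) =
      c • ((v s : ℂ) * (1 - ζ * Complex.exp (-(s * Complex.I)))⁻¹) := by
    intro s
    have : ‖ζ * Complex.exp (-(s * Complex.I))‖ < 1 := by rwa [norm_mul_exp_neg]
    exact (((hasSum_geometric_of_norm_lt_one this).mul_left (v s : ℂ)).const_smul c).tsum_eq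
  simp only [hgeo]
  have hi1 : Integrable (fun s : ℝ => c • (v s : ℂ)) angleMeasure := by
    simpa using hint 0
  have hi2 : Integrable (fun s : ℝ => c • ((v s : ℂ) * discKernel ζ s)) angleMeasure := by
    refine Integrable.smul c ?_
    have hk := continuous_discKernel hζ
    obtain ⟨C, hC⟩ := isCompact_Icc.exists_bound_of_continuousOn (s := Icc 0 (2 * Real.pi)) hk.continuousOn
    refine Integrable.of_bound (hvc.mul hk.aestronglyMeasurable) (K * C) ?_
    filter_upwards [hK, ae_restrict_mem measurableSet_Ioc] with t h1 h2
    rw [norm_mul, Complex.norm_real]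
    exact mul_le_mul h1 (hC t (Ioc_subset_Icc_self h2)) (norm_nonneg _) ((abs_nonneg _).trans h1)
  have e : ∀ s : ℝ, c • ((v s : ℂ) * (1 - ζ * Complex.exp (-(s * Complex.I)))⁻¹) =
      (1 / 2 : ℂ) * (c • ((v s : ℂ) * discKernel ζ s) + c • (v s : ℂ)) := by
    intro s
    rw [← smul_add, mul_smul_comm]
    congr 1
    rw [discKernel]
    ring
  simp only [e]
  rw [integral_const_mul, integral_add hi2 hi1, h0, integral_smul]
  ring

lemma coef_one (n : ℤ) : coef 0 (fun _ => ((1 : ℝ) : ℂ)) n = if n = 0 then 1 else 0 := by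
  have h := integral_exp_int (-n)
  rw [coef_eq]
  have e : ∀ t : ℝ, Complex.exp (-((n + ((0 : ℝ) : ℂ)) * t * Complex.I)) * ((1 : ℝ) : ℂ) =
      Complex.exp (((-n : ℤ) : ℂ) * t * Complex.I) := by
    intro t
    simp
  simp only [e, h, neg_eq_zero]
  have : (Real.pi : ℂ) ≠ 0 := by exact_mod_cast Real.pi_ne_zero
  split_ifs
  · simp
    field_simp
  · simp

/-- This is the Herglotz formula for `v = 1`, whose power series is the constant `1`. -/
lemma integral_discKernel {ζ : ℂ} (hζ : ‖ζ‖ < 1) :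
    ∫ s, discKernel ζ s ∂angleMeasure = 2 * Real.pi := by
  obtain ⟨A, hA, h⟩ := hasSum_coef_mul_pow (v := fun _ => 1) (K := 1) aestronglyMeasurable_const
    (by simp) hζ
  have hA1 : A = 1 := by
    refine hA.unique ?_
    convert! hasSum_ite_eq (0 : ℕ) (1 : ℂ) using 2 with n
    rw [coef_one]
    by_cases h : n = 0 <;> simp [h]
  rw [hA1, coef_one] at h
  have : (Real.pi : ℂ) ≠ 0 := by exact_mod_cast Real.pi_ne_zero
  simp at h
  norm_num at h
  field_simp at h
  rw [← h, mul_comm]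

/-- The real part is an average of `v` against the Poisson kernel, which is nonnegative of total
mass `2π`; averaging does not increase a bound. -/
lemma abs_re_hasSum_coef_le {v : ℝ → ℝ} {K : ℝ} (hv : AEStronglyMeasurable v angleMeasure)
    (hK : ∀ᵐ t ∂angleMeasure, |v t| ≤ K) {ζ : ℂ} (hζ : ‖ζ‖ < 1) :
    ∃ A : ℂ, HasSum (fun n : ℕ => coef 0 (fun t => (v t : ℂ)) n * ζ ^ n) A ∧
      |(2 * A - coef 0 (fun t => (v t : ℂ)) 0).re| ≤ K := by
  obtain ⟨A, hA, h⟩ := hasSum_coef_mul_pow hv hK hζ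
  refine ⟨A, hA, ?_⟩
  have hvc : AEStronglyMeasurable (fun t => (v t : ℂ)) angleMeasure :=
    Complex.continuous_ofReal.comp_aestronglyMeasurable hv
  have hk := continuous_discKernel hζ
  obtain ⟨C, hC⟩ := isCompact_Icc.exists_bound_of_continuousOn (s := Icc 0 (2 * Real.pi)) hk.continuousOn
  have hki : Integrable (discKernel ζ) angleMeasure := by
    refine Integrable.of_bound hk.aestronglyMeasurable C ?_
    filter_upwards [ae_restrict_mem measurableSet_Ioc] with t h2 using hC t (Ioc_subset_Icc_self h2)
  have hi2 : Integrable (fun s : ℝ => (v s : ℂ) * discKernel ζ s) angleMeasure := by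
    refine hki.bdd_mul hvc (c := K) ?_
    filter_upwards [hK] with t h1
    rwa [Complex.norm_real]
  rw [h, Complex.smul_re, smul_eq_mul, abs_mul, ← RCLike.re_eq_complex_re, ← integral_re hi2]
  have hre : ∀ s, RCLike.re ((v s : ℂ) * discKernel ζ s) = v s * (discKernel ζ s).re := by
    intro s; simp
  simp only [hre]
  have h1 : |∫ s, v s * (discKernel ζ s).re ∂angleMeasure| ≤ K * (2 * Real.pi) := by
    have e : (∫ s, (discKernel ζ s).re ∂angleMeasure) = 2 * Real.pi := by
      have := integral_re hki
      simp only [RCLike.re_eq_complex_re] at this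
      rw [this, integral_discKernel hζ]
      simp
    rw [← e, ← integral_const_mul, ← Real.norm_eq_abs]
    refine norm_integral_le_of_norm_le (hki.re.const_mul K) ?_
    filter_upwards [hK] with s hs
    rw [norm_mul, Real.norm_eq_abs, Real.norm_eq_abs, abs_of_nonneg (discKernel_re_nonneg hζ s)]
    exact mul_le_mul_of_nonneg_right hs (discKernel_re_nonneg hζ s)
  have := Real.pi_pos
  rw [abs_of_nonneg (by positivity), one_div, inv_mul_le_iff₀ (by positivity)]
  linarith

/-! ### Laurent coefficients for the Dirichlet problem on the annulus. -/

/-- Coefficients `c n` of a Laurent series whose real part has Fourier coefficients `a n` on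
`|z| = 1` and `b n` on `|z| = q`, provided `a` and `b` come from real functions of equal mean. -/
noncomputable def dirichletCoef (q : ℝ) (a b : ℤ → ℂ) (n : ℤ) : ℂ :=
  if n = 0 then a 0 else 2 * (b n - a n * (q : ℂ) ^ (-n)) / ((q : ℂ) ^ n - (q : ℂ) ^ (-n))

section

variable {q : ℝ} {a b : ℤ → ℂ}

lemma pow_two_mul_ne_one (hq0 : 0 < q) (hq1 : q < 1) {k : ℕ} (hk : k ≠ 0) :
    (1 : ℂ) - (q : ℂ) ^ (2 * k) ≠ 0 := by
  have : q ^ (2 * k) < 1 := pow_lt_one₀ hq0.le hq1 (by positivity)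
  intro h
  have h2 : ((1 - q ^ (2 * k) : ℝ) : ℂ) = 0 := by push_cast; exact h
  rw [Complex.ofReal_eq_zero] at h2
  linarith

lemma le_norm_one_sub_pow (hq0 : 0 < q) (hq1 : q < 1) {k : ℕ} (hk : k ≠ 0) :
    1 - q ≤ ‖(1 : ℂ) - (q : ℂ) ^ (2 * k)‖ := by
  have h1 : q ^ (2 * k) ≤ q := pow_le_of_le_one hq0.le hq1.le (by positivity)
  have e : (1 : ℂ) - (q : ℂ) ^ (2 * k) = ((1 - q ^ (2 * k) : ℝ) : ℂ) := by push_cast; rfl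
  rw [e, Complex.norm_real, Real.norm_of_nonneg (by linarith)]
  linarith

/-- Clearing `q ^ (-k)` leaves a denominator bounded below by `1 - q`, the form needed for
estimates. -/
lemma dirichletCoef_natCast (hq0 : 0 < q) (hq1 : q < 1) {k : ℕ} (hk : k ≠ 0) :
    dirichletCoef q a b k = 2 * (a k - q ^ k * b k) / (1 - (q : ℂ) ^ (2 * k)) := by
  have hq : (q : ℂ) ≠ 0 := by exact_mod_cast hq0.ne'
  have h1 := pow_two_mul_ne_one hq0 hq1 hk
  have h2 : (q : ℂ) ^ k - ((q : ℂ) ^ k)⁻¹ ≠ 0 := by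
    have : (q : ℂ) ^ k - ((q : ℂ) ^ k)⁻¹ = -(1 - (q : ℂ) ^ (2 * k)) * ((q : ℂ) ^ k)⁻¹ := by
      field_simp
      ring
    rw [this]
    exact mul_ne_zero (neg_ne_zero.mpr h1) (by positivity)
  rw [dirichletCoef, if_neg (by exact_mod_cast hk), zpow_neg, zpow_natCast, div_eq_div_iff h2 h1]
  field_simp
  ring

lemma dirichletCoef_neg_natCast (hq0 : 0 < q) (hq1 : q < 1) {k : ℕ} (hk : k ≠ 0) :
    dirichletCoef q a b (-k) =
      2 * q ^ k * (b (-k) - q ^ k * a (-k)) / (1 - (q : ℂ) ^ (2 * k)) := by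
  have hq : (q : ℂ) ≠ 0 := by exact_mod_cast hq0.ne'
  have h1 := pow_two_mul_ne_one hq0 hq1 hk
  have h2 : ((q : ℂ) ^ k)⁻¹ - (q : ℂ) ^ k ≠ 0 := by
    have : ((q : ℂ) ^ k)⁻¹ - (q : ℂ) ^ k = (1 - (q : ℂ) ^ (2 * k)) * ((q : ℂ) ^ k)⁻¹ := by
      field_simp
      ring
    rw [this]
    exact mul_ne_zero h1 (by positivity)
  rw [dirichletCoef, if_neg (by simpa using hk), neg_neg, zpow_neg, zpow_natCast,
    div_eq_div_iff h2 h1]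
  field_simp
  ring

/-- The two bounds give square summability on `|z| = 1` and on `|z| = q`. For `n = -k < 0` the
weight `q ^ n` is large, but the numerator of the coefficient contains the compensating factor `q ^
k`. -/
lemma norm_dirichletCoef_le (hq0 : 0 < q) (hq1 : q < 1) (n : ℤ) :
    ‖dirichletCoef q a b n‖ ≤ 2 / (1 - q) * (‖a n‖ + ‖b n‖) ∧
      ‖dirichletCoef q a b n‖ * q ^ n ≤ 2 / (1 - q) * (‖a n‖ + ‖b n‖) := by
  have hq' : 0 < 1 - q := by linarith
  have hqn : ‖(q : ℂ)‖ = q := by rw [Complex.norm_real, Real.norm_of_nonneg hq0.le]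
  have aux : ∀ (k : ℕ), k ≠ 0 → ∀ x y z : ℂ, ‖x‖ ≤ ‖y‖ + ‖z‖ →
      ‖2 * x / (1 - (q : ℂ) ^ (2 * k))‖ ≤ 2 / (1 - q) * (‖y‖ + ‖z‖) := by
    intro k hk x y z h
    have := le_norm_one_sub_pow hq0 hq1 hk
    rw [norm_div, norm_mul, Complex.norm_ofNat, div_mul_eq_mul_div]
    gcongr
  have aux2 : ∀ (k : ℕ) (y z : ℂ), ‖y - (q : ℂ) ^ k * z‖ ≤ ‖y‖ + ‖z‖ := by
    intro k y z
    refine (norm_sub_le _ _).trans ?_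
    rw [norm_mul, norm_pow, hqn]
    have : q ^ k ≤ 1 := pow_le_one₀ hq0.le hq1.le
    gcongr
    nlinarith [norm_nonneg z]
  rcases eq_or_ne n 0 with rfl | hn
  · have h2 : ‖dirichletCoef q a b 0‖ ≤ 2 / (1 - q) * (‖a 0‖ + ‖b 0‖) := by
      rw [dirichletCoef, if_pos rfl]
      have : 1 ≤ 2 / (1 - q) := by rw [le_div_iff₀ hq']; linarith
      nlinarith [norm_nonneg (a 0), norm_nonneg (b 0)]
    exact ⟨h2, by simpa using h2⟩
  obtain ⟨k, rfl | rfl⟩ := n.eq_nat_or_neg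
  · have hk : k ≠ 0 := by simpa using hn
    have h : ‖dirichletCoef q a b k‖ ≤ 2 / (1 - q) * (‖a k‖ + ‖b k‖) := by
      rw [dirichletCoef_natCast hq0 hq1 hk]
      exact aux k hk _ _ _ (aux2 _ _ _)
    refine ⟨h, le_trans ?_ h⟩
    rw [zpow_natCast]
    exact mul_le_of_le_one_right (norm_nonneg _) (pow_le_one₀ hq0.le hq1.le)
  · have hk : k ≠ 0 := by simpa using hn
    have h : ‖dirichletCoef q a b (-k)‖ * q ^ (-k : ℤ) ≤ 2 / (1 - q) * (‖a (-k)‖ + ‖b (-k)‖) := by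
      rw [dirichletCoef_neg_natCast hq0 hq1 hk, zpow_neg, zpow_natCast]
      have e : 2 * (q : ℂ) ^ k * (b (-k) - q ^ k * a (-k)) / (1 - (q : ℂ) ^ (2 * k)) =
        q ^ k * (2 * (b (-k) - q ^ k * a (-k)) / (1 - (q : ℂ) ^ (2 * k))) := by ring
      rw [e, norm_mul, norm_pow, hqn, mul_comm, inv_mul_cancel_left₀ (by positivity), add_comm]
      exact aux k hk _ _ _ (aux2 _ _ _)
    refine ⟨le_trans ?_ h, h⟩
    refine le_mul_of_one_le_right (norm_nonneg _) ?_
    rw [zpow_neg, zpow_natCast]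
    exact (one_le_inv₀ (by positivity)).mpr (pow_le_one₀ hq0.le hq1.le)

lemma summable_dirichletCoef (hq0 : 0 < q) (hq1 : q < 1) (ha : Summable fun n => ‖a n‖ ^ 2)
    (hb : Summable fun n => ‖b n‖ ^ 2) :
    (Summable fun n => ‖dirichletCoef q a b n‖ ^ 2) ∧
      Summable fun n : ℤ => (‖dirichletCoef q a b n‖ * q ^ n) ^ 2 := by
  have hs : Summable fun n : ℤ => (2 / (1 - q)) ^ 2 * (2 * (‖a n‖ ^ 2 + ‖b n‖ ^ 2)) :=
    ((ha.add hb).mul_left _).mul_left _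
  have key : ∀ x y z : ℝ, 0 ≤ x → x ≤ 2 / (1 - q) * (y + z) →
      x ^ 2 ≤ (2 / (1 - q)) ^ 2 * (2 * (y ^ 2 + z ^ 2)) := by
    intro x y z h0 h
    calc x ^ 2 ≤ (2 / (1 - q) * (y + z)) ^ 2 := by gcongr
      _ = (2 / (1 - q)) ^ 2 * (y + z) ^ 2 := by ring
      _ ≤ _ := by gcongr; nlinarith [sq_nonneg (y - z)]
  exact ⟨Summable.of_nonneg_of_le (fun _ => by positivity)
      (fun n => key _ _ _ (norm_nonneg _) (norm_dirichletCoef_le hq0 hq1 n).1) hs,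
    Summable.of_nonneg_of_le (fun _ => by positivity)
      (fun n => key _ _ _ (by positivity) (norm_dirichletCoef_le hq0 hq1 n).2) hs⟩

lemma zpow_sub_zpow_neg_ne_zero (hq0 : 0 < q) (hq1 : q < 1) {n : ℤ} (hn : n ≠ 0) :
    (q : ℂ) ^ n - (q : ℂ) ^ (-n) ≠ 0 := by
  intro h
  have h2 : q ^ n = q ^ (-n) := by
    have := sub_eq_zero.mp h
    exact_mod_cast this
  have := zpow_right_injective₀ hq0 hq1.ne h2
  omega

/-- For `n ≠ 0` this relation and the next form a linear system in `c n` and `conj (c (-n))`, and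
`dirichletCoef` is its solution. They say that the real part of the series has the prescribed
coefficients on the outer and on the inner circle. -/
lemma dirichletCoef_add_conj (hq0 : 0 < q) (hq1 : q < 1)
    (ha : ∀ n, (starRingEnd ℂ) (a (-n)) = a n) (hb : ∀ n, (starRingEnd ℂ) (b (-n)) = b n) (n : ℤ) :
    dirichletCoef q a b n + (starRingEnd ℂ) (dirichletCoef q a b (-n)) = 2 * a n := by
  rcases eq_or_ne n 0 with rfl | hn
  · have := ha 0
    simp only [neg_zero] at this
    simp [dirichletCoef, this]
    ring
  · have h := zpow_sub_zpow_neg_ne_zero hq0 hq1 hn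
    have h' : (q : ℂ) ^ (-n) - (q : ℂ) ^ n ≠ 0 := by rw [← neg_sub]; exact neg_ne_zero.mpr h
    have e : (q : ℂ) ^ (-n) * (q : ℂ) ^ n = 1 := by
      rw [← zpow_add₀ (by exact_mod_cast hq0.ne')]; simp
    simp only [dirichletCoef, hn, neg_eq_zero, if_false, map_div₀, map_mul, map_sub, map_zpow₀,
      Complex.conj_ofReal, ha, hb, neg_neg, map_ofNat]
    field_simp
    ring

/-- At `n = 0` the system degenerates, both equations having the same left side. This is where
equality of the means enters. -/
lemma dirichletCoef_add_conj_zpow (hq0 : 0 < q) (hq1 : q < 1)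
    (ha : ∀ n, (starRingEnd ℂ) (a (-n)) = a n) (hb : ∀ n, (starRingEnd ℂ) (b (-n)) = b n)
    (hab : a 0 = b 0) (n : ℤ) :
    (q : ℂ) ^ n * dirichletCoef q a b n +
      (q : ℂ) ^ (-n) * (starRingEnd ℂ) (dirichletCoef q a b (-n)) = 2 * b n := by
  rcases eq_or_ne n 0 with rfl | hn
  · have := hb 0
    simp only [neg_zero] at this
    simp [dirichletCoef, hab, this]
    ring
  · have h := zpow_sub_zpow_neg_ne_zero hq0 hq1 hn
    have h' : (q : ℂ) ^ (-n) - (q : ℂ) ^ n ≠ 0 := by rw [← neg_sub]; exact neg_ne_zero.mpr h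
    have e : (q : ℂ) ^ (-n) * (q : ℂ) ^ n = 1 := by
      rw [← zpow_add₀ (by exact_mod_cast hq0.ne')]; simp
    simp only [dirichletCoef, hn, neg_eq_zero, if_false, map_div₀, map_mul, map_sub, map_zpow₀,
      Complex.conj_ofReal, ha, hb, neg_neg, map_ofNat]
    generalize (q : ℂ) ^ (-n) = x at *
    generalize (q : ℂ) ^ n = y at *
    field_simp
    ring

end

/-! ### Boundedness of the real part, and the Dirichlet problem. -/

lemma conj_coef_neg (v : ℝ → ℝ) (n : ℤ) :
    (starRingEnd ℂ) (coef 0 (fun t => (v t : ℂ)) (-n)) = coef 0 (fun t => (v t : ℂ)) n := by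
  rw [← coef_conj]
  simp

section

variable {q K : ℝ} {v₁ v₂ : ℝ → ℝ}

/-- For `n > 0` the coefficient differs from `2 * a n` by `O(q ^ n)`. Up to an absolutely bounded
error the series is therefore `2 ∑ a n ζ ^ n - a 0`, whose real part is the Poisson integral of
`v₁`. -/
lemma exists_hasSum_dirichletCoef_nat (hq0 : 0 < q) (hq1 : q < 1)
    (hm₁ : AEStronglyMeasurable v₁ angleMeasure)
    (hK₁ : ∀ᵐ t ∂angleMeasure, |v₁ t| ≤ K) (hK₂ : ∀ᵐ t ∂angleMeasure, |v₂ t| ≤ K)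
    {ζ : ℂ} (hζ1 : ‖ζ‖ < 1) :
    ∃ S : ℂ, HasSum (fun n : ℕ => dirichletCoef q (coef 0 (fun t => (v₁ t : ℂ)))
      (coef 0 (fun t => (v₂ t : ℂ))) n * ζ ^ n) S ∧
        |S.re| ≤ K + 4 * K / (1 - q) * (1 - q)⁻¹ := by
  set a := coef 0 (fun t => (v₁ t : ℂ)) with ha
  set b := coef 0 (fun t => (v₂ t : ℂ)) with hb
  have hK0 : 0 ≤ K := (norm_nonneg _).trans (norm_coef_le hK₁ 0)
  have hq' : 0 < 1 - q := by linarith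
  have hqn : ‖(q : ℂ)‖ = q := by rw [Complex.norm_real, Real.norm_of_nonneg hq0.le]
  obtain ⟨A, hA, hAK⟩ := abs_re_hasSum_coef_le hm₁ hK₁ hζ1
  have hP := (hA.mul_left 2).sub (hasSum_ite_eq (0 : ℕ) (a 0))
  set d : ℕ → ℂ := fun n => dirichletCoef q a b n * ζ ^ n -
    (2 * (a n * ζ ^ n) - if n = 0 then a 0 else 0) with hd
  have hdb : ∀ n, ‖d n‖ ≤ 4 * K / (1 - q) * q ^ n := by
    intro n
    rcases eq_or_ne n 0 with rfl | hn
    · simp [hd, dirichletCoef]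
      ring_nf
      simp
      positivity
    · have h1 := pow_two_mul_ne_one hq0 hq1 hn
      have e : d n = 2 * q ^ n * (q ^ n * a n - b n) / (1 - (q : ℂ) ^ (2 * n)) * ζ ^ n := by
        simp only [hd, if_neg hn]
        rw [dirichletCoef_natCast hq0 hq1 hn]
        field_simp
        ring
      rw [e, norm_mul, norm_div, norm_mul, norm_mul, norm_pow, norm_pow, hqn, Complex.norm_ofNat]
      have h2 : ‖(q : ℂ) ^ n * a n - b n‖ ≤ 2 * K := by
        refine (norm_sub_le _ _).trans ?_
        rw [norm_mul, norm_pow, hqn]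
        have h3 : q ^ n ≤ 1 := pow_le_one₀ hq0.le hq1.le
        have h4 : q ^ n * ‖a n‖ ≤ 1 * K := by gcongr; exact norm_coef_le hK₁ _
        have h5 : ‖b n‖ ≤ K := norm_coef_le hK₂ _
        linarith
      have h6 := le_norm_one_sub_pow hq0 hq1 hn
      have h7 : ‖ζ‖ ^ n ≤ 1 := pow_le_one₀ (norm_nonneg _) hζ1.le
      calc 2 * q ^ n * ‖(q : ℂ) ^ n * a n - b n‖ / ‖1 - (q : ℂ) ^ (2 * n)‖ * ‖ζ‖ ^ n
          ≤ 2 * q ^ n * (2 * K) / (1 - q) * 1 := by gcongr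
        _ = _ := by ring
  have hg : HasSum (fun n : ℕ => 4 * K / (1 - q) * q ^ n) (4 * K / (1 - q) * (1 - q)⁻¹) :=
    (hasSum_geometric_of_lt_one hq0.le hq1).mul_left _
  obtain ⟨D, hD⟩ := Summable.of_norm_bounded hg.summable hdb
  have hDn := hD.norm_le_of_bounded hg hdb
  refine ⟨2 * A - a 0 + D, ?_, ?_⟩
  · refine (hP.add hD).congr_fun ?_
    intro n
    simp [hd, ha]
  · rw [Complex.add_re]
    refine (abs_add_le _ _).trans (add_le_add hAK ((Complex.abs_re_le_norm _).trans hDn))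

/-- The reflection `ζ ↦ q / conj ζ` exchanges the two circles and turns the negative half of the
series, up to `O(q ^ n)` terms, into the conjugate of the Poisson series of `v₂`. The sum starts at
exponent `-1`, and removing the zeroth term costs the extra `K`. -/
lemma exists_hasSum_dirichletCoef_neg (hq0 : 0 < q) (hq1 : q < 1)
    (hm₂ : AEStronglyMeasurable v₂ angleMeasure)
    (hK₁ : ∀ᵐ t ∂angleMeasure, |v₁ t| ≤ K) (hK₂ : ∀ᵐ t ∂angleMeasure, |v₂ t| ≤ K)
    {ζ : ℂ} (hζ1 : q < ‖ζ‖) :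
    ∃ S : ℂ, HasSum (fun n : ℕ => dirichletCoef q (coef 0 (fun t => (v₁ t : ℂ)))
      (coef 0 (fun t => (v₂ t : ℂ))) (-(n + 1)) * ζ ^ (-(n + 1) : ℤ)) S ∧
        |S.re| ≤ 2 * K + 4 * K / (1 - q) * (1 - q)⁻¹ := by
  set a := coef 0 (fun t => (v₁ t : ℂ)) with ha
  set b := coef 0 (fun t => (v₂ t : ℂ)) with hb
  have hK0 : 0 ≤ K := (norm_nonneg _).trans (norm_coef_le hK₁ 0)
  have hq' : 0 < 1 - q := by linarith
  have hqn : ‖(q : ℂ)‖ = q := by rw [Complex.norm_real, Real.norm_of_nonneg hq0.le]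
  have hζ0 : 0 < ‖ζ‖ := hq0.trans hζ1
  have hζne : ζ ≠ 0 := norm_pos_iff.mp hζ0
  set η : ℂ := q / (starRingEnd ℂ) ζ with hη
  have hη1 : ‖η‖ < 1 := by
    rw [hη, norm_div, hqn, RCLike.norm_conj, div_lt_one hζ0]
    exact hζ1
  obtain ⟨A, hA, hAK⟩ := abs_re_hasSum_coef_le hm₂ hK₂ hη1
  have hA' : HasSum (fun n : ℕ => b (n + 1 : ℕ) * η ^ (n + 1)) (A - b 0) := by
    have := (hasSum_nat_add_iff' 1).mpr hA
    simpa using this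
  have hP : HasSum (fun n : ℕ => 2 * (starRingEnd ℂ) (b (n + 1 : ℕ) * η ^ (n + 1)))
      (2 * (starRingEnd ℂ) (A - b 0)) := (Complex.hasSum_conj'.mpr (by simpa using hA')).mul_left 2
  set d : ℕ → ℂ := fun n => dirichletCoef q a b (-(n + 1)) * ζ ^ (-(n + 1) : ℤ) -
    2 * (starRingEnd ℂ) (b (n + 1 : ℕ) * η ^ (n + 1)) with hd
  have hdb : ∀ n, ‖d n‖ ≤ 4 * K / (1 - q) * q ^ n := by
    intro n
    obtain ⟨k, hk⟩ : ∃ k, k = n + 1 := ⟨_, rfl⟩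
    have hk0 : k ≠ 0 := by omega
    have h1 := pow_two_mul_ne_one hq0 hq1 hk0
    have e : d n = 2 * q ^ k * (q ^ k * b (-k) - a (-k)) / (1 - (q : ℂ) ^ (2 * k)) * (q / ζ) ^ k := by
      have e1 : (starRingEnd ℂ) (b (n + 1 : ℕ) * η ^ (n + 1)) = b (-k) * (q / ζ) ^ k := by
        have h3 := conj_coef_neg v₂ (-k)
        rw [neg_neg] at h3
        rw [← hk, map_mul, ← hb] at *
        rw [h3, map_pow, hη, map_div₀, Complex.conj_ofReal, Complex.conj_conj]
      have e2 : (-((n : ℤ) + 1)) = -(k : ℤ) := by rw [hk]; push_cast; ring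
      simp only [hd]
      rw [e1, e2, dirichletCoef_neg_natCast hq0 hq1 hk0, zpow_neg, zpow_natCast, div_pow]
      field_simp
      ring
    rw [e, norm_mul, norm_div, norm_mul, norm_mul, norm_pow, norm_pow, norm_div, hqn,
      Complex.norm_ofNat]
    have h2 : ‖(q : ℂ) ^ k * b (-k) - a (-k)‖ ≤ 2 * K := by
      refine (norm_sub_le _ _).trans ?_
      rw [norm_mul, norm_pow, hqn]
      have h3 : q ^ k ≤ 1 := pow_le_one₀ hq0.le hq1.le
      have h4 : q ^ k * ‖b (-k)‖ ≤ 1 * K := by gcongr; exact norm_coef_le hK₂ _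
      have h5 : ‖a (-k)‖ ≤ K := norm_coef_le hK₁ _
      linarith
    have h6 := le_norm_one_sub_pow hq0 hq1 hk0
    have h7 : (q / ‖ζ‖) ^ k ≤ 1 := pow_le_one₀ (by positivity) ((div_le_one hζ0).mpr hζ1.le)
    have h8 : q ^ k ≤ q ^ n := pow_le_pow_of_le_one hq0.le hq1.le (by omega)
    calc 2 * q ^ k * ‖(q : ℂ) ^ k * b (-k) - a (-k)‖ / ‖1 - (q : ℂ) ^ (2 * k)‖ * (q / ‖ζ‖) ^ k
        ≤ 2 * q ^ n * (2 * K) / (1 - q) * 1 := by gcongr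
      _ = _ := by ring
  have hg : HasSum (fun n : ℕ => 4 * K / (1 - q) * q ^ n) (4 * K / (1 - q) * (1 - q)⁻¹) :=
    (hasSum_geometric_of_lt_one hq0.le hq1).mul_left _
  obtain ⟨D, hD⟩ := Summable.of_norm_bounded hg.summable hdb
  have hDn := hD.norm_le_of_bounded hg hdb
  refine ⟨2 * (starRingEnd ℂ) (A - b 0) + D, ?_, ?_⟩
  · refine (hP.add hD).congr_fun ?_
    intro n
    simp [hd]
  · rw [Complex.add_re]
    refine (abs_add_le _ _).trans (add_le_add ?_ ((Complex.abs_re_le_norm _).trans hDn))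
    have h1 : |(b 0).re| ≤ K := (Complex.abs_re_le_norm _).trans (norm_coef_le hK₂ 0)
    have e : (2 * (starRingEnd ℂ) (A - b 0)).re = (2 * A - b 0).re - (b 0).re := by
      simp
      ring
    rw [e]
    refine (abs_sub _ _).trans ?_
    linarith

/-- Uniformity in `r` up to both circles is what makes the exponentials of the series and of its
negative bounded. -/
lemma abs_re_laurent_dirichletCoef_le (hq0 : 0 < q) (hq1 : q < 1)
    (hm₁ : AEStronglyMeasurable v₁ angleMeasure) (hm₂ : AEStronglyMeasurable v₂ angleMeasure)
    (hK₁ : ∀ᵐ t ∂angleMeasure, |v₁ t| ≤ K) (hK₂ : ∀ᵐ t ∂angleMeasure, |v₂ t| ≤ K)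
    {r : ℝ} (hr : r ∈ Ioo q 1) (t : ℝ) :
    |(laurent 0 (dirichletCoef q (coef 0 (fun t => (v₁ t : ℂ)))
      (coef 0 (fun t => (v₂ t : ℂ)))) (r, t)).re| ≤
        K + 4 * K / (1 - q) * (1 - q)⁻¹ + (2 * K + 4 * K / (1 - q) * (1 - q)⁻¹) := by
  have hr0 := hq0.trans hr.1
  set ζ : ℂ := Complex.exp (Real.log r + t * Complex.I) with hζ
  have hζn : ‖ζ‖ = r := by
    rw [hζ, Complex.norm_exp]
    simp [Real.exp_log hr0]
  obtain ⟨S, hS, hSK⟩ := exists_hasSum_dirichletCoef_nat hq0 hq1 hm₁ hK₁ hK₂ (ζ := ζ)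
    (by rw [hζn]; exact hr.2)
  obtain ⟨S', hS', hSK'⟩ := exists_hasSum_dirichletCoef_neg hq0 hq1 hm₂ hK₁ hK₂ (ζ := ζ)
    (by rw [hζn]; exact hr.1)
  set c := dirichletCoef q (coef 0 (fun t => (v₁ t : ℂ))) (coef 0 (fun t => (v₂ t : ℂ)))
  have h := HasSum.of_nat_of_neg_add_one (f := fun n : ℤ => c n * ζ ^ n)
    (by simpa using hS) hS'
  have e : laurent 0 c (r, t) = S + S' := by
    rw [← h.tsum_eq, laurent]
    congr 1
    ext n
    rw [hζ, ← Complex.exp_int_mul]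
    simp
  rw [e, Complex.add_re]
  exact (abs_add_le _ _).trans (add_le_add hSK hSK')

lemma memLp_ofReal (hm : AEStronglyMeasurable v₁ angleMeasure)
    (hK : ∀ᵐ t ∂angleMeasure, |v₁ t| ≤ K) : MemLp (fun t => (v₁ t : ℂ)) 2 angleMeasure := by
  refine MemLp.of_bound (Complex.continuous_ofReal.comp_aestronglyMeasurable hm) K ?_
  filter_upwards [hK] with t ht
  rwa [Complex.norm_real]

lemma re_ae_eq_of_coef {h : ℝ → ℂ} (hh : MemLp h 2 angleMeasure)
    (hm : AEStronglyMeasurable v₁ angleMeasure) (hK : ∀ᵐ t ∂angleMeasure, |v₁ t| ≤ K)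
    (hc : ∀ n, coef 0 h n + (starRingEnd ℂ) (coef 0 h (-n)) = 2 * coef 0 (fun t => (v₁ t : ℂ)) n) :
    ∀ᵐ t ∂angleMeasure, (h t).re = v₁ t := by
  have hv := memLp_ofReal hm hK
  have hconj : MemLp (fun t => (starRingEnd ℂ) (h t)) 2 angleMeasure := hh.star
  have := ae_eq_of_coef_eq (α := 0) (hh.add hconj) (hv.add hv) (fun n => by
    have h1 := coef_add (α := 0) hh hconj n
    have h2 := coef_add (α := 0) hv hv n
    refine h1.trans (Eq.trans ?_ h2.symm)
    rw [coef_conj, hc]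
    ring)
  filter_upwards [this] with t ht
  simp only [Pi.add_apply, Complex.add_conj] at ht
  have : ((2 * (h t).re : ℝ) : ℂ) = ((2 * v₁ t : ℝ) : ℂ) := by
    rw [ht]; push_cast; ring
  have := Complex.ofReal_injective this
  linarith

/-- Solution of the Dirichlet problem on the annulus, as the real part of a Laurent series. -/
theorem exists_automorphic_re_eq (hq0 : 0 < q) (hq1 : q < 1)
    (hm₁ : AEStronglyMeasurable v₁ angleMeasure) (hm₂ : AEStronglyMeasurable v₂ angleMeasure)
    (hK₁ : ∀ᵐ t ∂angleMeasure, |v₁ t| ≤ K) (hK₂ : ∀ᵐ t ∂angleMeasure, |v₂ t| ≤ K)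
    (h0 : coef 0 (fun t => (v₁ t : ℂ)) 0 = coef 0 (fun t => (v₂ t : ℂ)) 0) :
    ∃ (H : ℝ × ℝ → ℂ) (h₁ h₂ : ℝ → ℂ) (C : ℝ), IsAutomorphic q 0 H ∧
      MemLp h₁ 2 angleMeasure ∧ MemLp h₂ 2 angleMeasure ∧
      (∀ r ∈ Ioo q 1, ∀ t, |(H (r, t)).re| ≤ C) ∧
      Tendsto (fun r : ℝ => eLpNorm (fun t => H (r, t) - h₁ t) 2 angleMeasure) (𝓝[<] 1) (𝓝 0) ∧
      Tendsto (fun r : ℝ => eLpNorm (fun t => H (r, t) - h₂ t) 2 angleMeasure) (𝓝[>] q) (𝓝 0) ∧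
      (∀ᵐ t ∂angleMeasure, (h₁ t).re = v₁ t) ∧ (∀ᵐ t ∂angleMeasure, (h₂ t).re = v₂ t) := by
  set a := coef 0 (fun t => (v₁ t : ℂ)) with ha
  set b := coef 0 (fun t => (v₂ t : ℂ)) with hb
  set c := dirichletCoef q a b with hc
  obtain ⟨s1, s2⟩ := summable_dirichletCoef hq0 hq1 (hasSum_coef 0 (memLp_ofReal hm₁ hK₁)).summable
    (hasSum_coef 0 (memLp_ofReal hm₂ hK₂)).summable
  have s2' : Summable fun n : ℤ => (‖c n‖ * q ^ (n + (0 : ℝ) : ℝ)) ^ 2 := by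
    simpa [Real.rpow_intCast] using s2
  obtain ⟨h₁, hh₁, hc₁⟩ := exists_memLp_coef_eq s1
  obtain ⟨h₂, hh₂, hc₂⟩ := exists_memLp_coef_eq (c := fun n => (q : ℂ) ^ n * c n) (by
    refine s2.congr fun n => ?_
    rw [norm_mul, norm_zpow, Complex.norm_real, Real.norm_of_nonneg hq0.le, mul_comm])
  have t1 := laurent_tendsto hq0 s1 s2' (s := 1) ⟨hq1.le, le_rfl⟩ hh₁ (by
    intro n; rw [hc₁]; simp)
  have t2 := laurent_tendsto hq0 s1 s2' (s := q) ⟨le_rfl, hq1.le⟩ hh₂ (by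
    intro n; rw [hc₂]; simp [Real.rpow_intCast, hc, ha, hb])
  rw [nhdsWithin_Ioo_eq_nhdsLT hq1] at t1
  rw [nhdsWithin_Ioo_eq_nhdsGT hq1] at t2
  refine ⟨laurent 0 c, h₁, h₂, _, laurent_automorphic hq0 s1 s2', hh₁, hh₂,
    fun r hr t => abs_re_laurent_dirichletCoef_le hq0 hq1 hm₁ hm₂ hK₁ hK₂ hr t, t1, t2, ?_, ?_⟩
  · refine re_ae_eq_of_coef hh₁ hm₁ hK₁ fun n => ?_
    rw [hc₁, hc₁]
    exact dirichletCoef_add_conj hq0 hq1 (conj_coef_neg v₁) (conj_coef_neg v₂) n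
  · refine re_ae_eq_of_coef hh₂ hm₂ hK₂ fun n => ?_
    rw [hc₂, hc₂, map_mul, map_zpow₀, Complex.conj_ofReal]
    exact dirichletCoef_add_conj_zpow hq0 hq1 (conj_coef_neg v₁) (conj_coef_neg v₂) h0 n

end

/-! ### Boundary values of products with exponentials. -/

lemma tendsto_eLpNorm_two_of_dominated {X : Type*} [MeasurableSpace X] {μ : Measure X}
    {f : ℕ → X → ℂ} {b : X → ℂ} (hf : ∀ n, AEStronglyMeasurable (f n) μ) (hb : MemLp b 2 μ)
    (hfb : ∀ n, ∀ᵐ x ∂μ, ‖f n x‖ ≤ ‖b x‖) (h0 : ∀ᵐ x ∂μ, Tendsto (fun n => f n x) atTop (𝓝 0)) :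
    Tendsto (fun n => eLpNorm (f n) 2 μ) atTop (𝓝 0) := by
  have h1 : Tendsto (fun n => ∫⁻ x, ‖f n x‖ₑ ^ (2 : ℝ) ∂μ) atTop (𝓝 (∫⁻ _, 0 ∂μ)) := by
    refine tendsto_lintegral_of_dominated_convergence' (fun x => ‖b x‖ₑ ^ (2 : ℝ))
      (fun n => (hf n).enorm.pow_const _) (fun n => ?_) ?_ ?_
    · filter_upwards [hfb n] with x hx
      refine ENNReal.rpow_le_rpow ?_ (by norm_num)
      exact enorm_le_iff_norm_le.mpr hx
    · have := lintegral_rpow_enorm_lt_top_of_eLpNorm_lt_top (by norm_num) (by norm_num) hb.2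
      simpa using this.ne
    · filter_upwards [h0] with x hx
      have := ((ENNReal.continuous_rpow_const (y := (2 : ℝ))).tendsto _).comp hx.enorm
      rw [enorm_zero, ENNReal.zero_rpow_of_pos (by norm_num)] at this
      exact this
  have h2 := ((ENNReal.continuous_rpow_const (y := (1 / 2 : ℝ))).tendsto _).comp h1
  rw [lintegral_zero, ENNReal.zero_rpow_of_pos (by norm_num)] at h2
  refine h2.congr fun n => ?_
  rw [eLpNorm_eq_lintegral_rpow_enorm_toReal (by norm_num) (by norm_num)]
  simp

lemma continuous_slice_exp {H : ℝ × ℝ → ℂ} {r : ℝ} (κ : ℝ)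
    (hH : Continuous fun t => H (r, t)) :
    Continuous fun t : ℝ => Complex.exp (H (r, t) + κ * (Real.log r + t * Complex.I)) := by
  exact Complex.continuous_exp.comp (hH.add (by fun_prop))

lemma norm_exp_add_mul (z : ℂ) (κ x t : ℝ) :
    ‖Complex.exp (z + κ * (x + t * Complex.I))‖ = Real.exp (z.re + κ * x) := by
  rw [Complex.norm_exp]
  simp

/-- Multiplication by `exp (H + κ w)`, where `H` has bounded real part, preserves the existence of
`L²` boundary values. -/
lemma tendsto_eLpNorm_mul_exp {q s C κ : ℝ} {l : Filter ℝ} [l.IsCountablyGenerated]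
    (hq0 : 0 < q) (hq1 : q < 1) (hs : s ∈ Icc q 1) (hl : l ≤ 𝓝 s) (hmem : ∀ᶠ r in l, r ∈ Ioo q 1)
    {H : ℝ × ℝ → ℂ} {h : ℝ → ℂ} (hHc : ∀ r ∈ Ioo q 1, Continuous fun t => H (r, t))
    (hC : ∀ r ∈ Ioo q 1, ∀ t, |(H (r, t)).re| ≤ C) (hh : MemLp h 2 angleMeasure)
    (hht : Tendsto (fun r : ℝ => eLpNorm (fun t => H (r, t) - h t) 2 angleMeasure) l (𝓝 0))
    {G : ℝ × ℝ → ℂ} {g : ℝ → ℂ} (hG : ∀ᶠ r in l, MemLp (fun t => G (r, t)) 2 angleMeasure)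
    (hg : MemLp g 2 angleMeasure)
    (hgt : Tendsto (fun r : ℝ => eLpNorm (fun t => G (r, t) - g t) 2 angleMeasure) l (𝓝 0)) :
    Tendsto (fun r : ℝ => eLpNorm (fun t : ℝ =>
      G (r, t) * Complex.exp (H (r, t) + κ * (Real.log r + t * Complex.I)) -
        g t * Complex.exp (h t + κ * (Real.log s + t * Complex.I))) 2 angleMeasure) l (𝓝 0) := by
  set E : ℝ → ℝ → ℂ := fun r t => Complex.exp (H (r, t) + κ * (Real.log r + t * Complex.I)) with hE
  set e : ℝ → ℂ := fun t => Complex.exp (h t + κ * (Real.log s + t * Complex.I)) with he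
  set B : ℝ := Real.exp (C + |κ| * |Real.log q|) with hB
  have hs0 : 0 < s := hq0.trans_le hs.1
  have hEB : ∀ r ∈ Ioo q 1, ∀ t, ‖E r t‖ ≤ B := by
    intro r hr t
    rw [hE, norm_exp_add_mul, Real.exp_le_exp]
    have h1 : |Real.log r| ≤ |Real.log q| := by
      have := Real.log_lt_log hq0 hr.1
      rw [abs_of_neg (Real.log_neg hq0 hq1), abs_of_neg (Real.log_neg (hq0.trans hr.1) hr.2)]
      linarith
    have h2 : κ * Real.log r ≤ |κ| * |Real.log q| := by
      refine (le_abs_self _).trans ?_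
      rw [abs_mul]
      gcongr
    linarith [le_abs_self (H (r, t)).re, hC r hr t]
  have hEm : ∀ r ∈ Ioo q 1, AEStronglyMeasurable (E r) angleMeasure := fun r hr =>
    (continuous_slice_exp κ (hHc r hr)).aestronglyMeasurable
  have hem : AEStronglyMeasurable e angleMeasure :=
    Complex.continuous_exp.comp_aestronglyMeasurable
      (hh.1.add (Continuous.aestronglyMeasurable (by fun_prop)))
  -- `L²` convergence of `H` yields almost everywhere convergence only along a subsequence. That
  -- suffices, since the limit in `hsecond` is tested on subsequences.
  have hsub : ∀ u : ℕ → ℝ, Tendsto u atTop l → ∃ ns : ℕ → ℕ, (∀ k, u (ns k) ∈ Ioo q 1) ∧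
      Tendsto ns atTop atTop ∧
      ∀ᵐ t ∂angleMeasure, Tendsto (fun k => E (u (ns k)) t) atTop (𝓝 (e t)) := by
    intro u hu
    obtain ⟨N, hN⟩ := eventually_atTop.mp (hu.eventually hmem)
    have hu' : Tendsto (fun k => u (k + N)) atTop l := hu.comp (tendsto_add_atTop_nat N)
    have hm := tendstoInMeasure_of_tendsto_eLpNorm (μ := angleMeasure) (p := 2)
      (f := fun k t => H (u (k + N), t)) (g := h) (l := atTop) (by norm_num)
      (fun k => (hHc _ (hN _ (by omega))).aestronglyMeasurable) hh.1 (hht.comp hu')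
    obtain ⟨ns, hns, hae⟩ := hm.exists_seq_tendsto_ae
    have hT : Tendsto (fun k => ns k + N) atTop atTop :=
      (tendsto_add_atTop_nat N).comp hns.tendsto_atTop
    refine ⟨fun k => ns k + N, fun k => hN _ (Nat.le_add_left _ _), hT, ?_⟩
    filter_upwards [hae] with t ht
    have hlog : Tendsto (fun k => Real.log (u (ns k + N))) atTop (𝓝 (Real.log s)) :=
      ((Real.continuousAt_log hs0.ne').tendsto.mono_left hl).comp (hu.comp hT)
    have hlog' : Tendsto (fun k => (Real.log (u (ns k + N)) : ℂ)) atTop (𝓝 (Real.log s : ℂ)) :=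
      (Complex.continuous_ofReal.tendsto _).comp hlog
    exact (Complex.continuous_exp.tendsto _).comp
      (ht.add ((hlog'.add_const (t * Complex.I)).const_mul (κ : ℂ)))
  have hfirst : Tendsto (fun r : ℝ => eLpNorm (fun t => (G (r, t) - g t) * E r t) 2 angleMeasure) l
      (𝓝 0) := by
    have h1 := ENNReal.Tendsto.const_mul (a := ENNReal.ofReal B) hgt (Or.inr ENNReal.ofReal_ne_top)
    rw [mul_zero] at h1
    refine tendsto_of_tendsto_of_tendsto_of_le_of_le' tendsto_const_nhds h1
      (Eventually.of_forall fun _ => zero_le) ?_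
    filter_upwards [hmem] with r hr
    refine eLpNorm_le_mul_eLpNorm_of_ae_le_mul (Eventually.of_forall fun t => ?_) 2
    rw [norm_mul, mul_comm]
    gcongr
    exact hEB r hr t
  have hsecond : Tendsto (fun r : ℝ => eLpNorm (fun t => g t * (E r t - e t)) 2 angleMeasure) l
      (𝓝 0) := by
    refine tendsto_of_subseq_tendsto fun u hu => ?_
    obtain ⟨ns, hns, -, hae⟩ := hsub u hu
    refine ⟨ns, tendsto_eLpNorm_two_of_dominated (b := fun t => (2 * B : ℝ) • g t)
      (fun k => hg.1.mul ((hEm _ (hns k)).sub hem)) (hg.const_smul (2 * B : ℝ)) (fun k => ?_) ?_⟩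
    · filter_upwards [hae] with t ht
      -- No bound on `Re h` is assumed; the bound on `e` is inherited from `E` in the almost
      -- everywhere limit.
      have h1 : ‖e t‖ ≤ B :=
        le_of_tendsto ht.norm (Eventually.of_forall fun k => hEB _ (hns k) t)
      rw [norm_mul, norm_smul, Real.norm_of_nonneg (by positivity), mul_comm]
      gcongr
      exact (norm_sub_le _ _).trans (by linarith [hEB _ (hns k) t])
    · filter_upwards [hae] with t ht
      simpa using (ht.sub_const (e t)).const_mul (g t)
  have hsum := hfirst.add hsecond
  rw [add_zero] at hsum
  refine tendsto_of_tendsto_of_tendsto_of_le_of_le' tendsto_const_nhds hsum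
    (Eventually.of_forall fun _ => zero_le) ?_
  filter_upwards [hmem, hG] with r hr hGr
  refine le_trans (le_of_eq ?_) (eLpNorm_add_le ((hGr.1.sub hg.1).mul (hEm r hr))
    (hg.1.mul ((hEm r hr).sub hem)) (by norm_num))
  congr 1
  ext t
  simp only [Pi.add_apply, hE, he]
  ring

/-! ### Outer functions of prescribed modulus and index. -/

/-- The angle of `z` in `(0, 2π]`. -/
noncomputable def angle (z : ℂ) : ℝ := if 0 < Complex.arg z then Complex.arg z else Complex.arg z + 2 * Real.pi

lemma measurable_angle : Measurable angle :=
  Measurable.ite (measurableSet_lt measurable_const Complex.measurable_arg) Complex.measurable_arg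
    (Complex.measurable_arg.add_const _)

lemma angle_circleMap {s t : ℝ} (hs : 0 < s) (ht : t ∈ Ioc 0 (2 * Real.pi)) :
    angle (circleMap 0 s t) = t := by
  rw [angle, circleMap_zero, Complex.arg_real_mul _ hs, Complex.arg_exp_mul_I]
  rcases le_or_gt t Real.pi with h | h
  · have : toIocMod Real.two_pi_pos (-Real.pi) t = t :=
      (toIocMod_eq_iff Real.two_pi_pos).mpr
        ⟨⟨by linarith [ht.1, Real.pi_pos], by linarith⟩, 0, by simp⟩
    rw [this, if_pos ht.1]
  · have : toIocMod Real.two_pi_pos (-Real.pi) t = t - 2 * Real.pi :=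
      (toIocMod_eq_iff Real.two_pi_pos).mpr
        ⟨⟨by linarith, by linarith [ht.2, Real.pi_pos]⟩, 1, by simp⟩
    rw [this, if_neg (by linarith [ht.2])]
    ring

instance isFiniteMeasure_circleMeasure (s : ℝ) : IsFiniteMeasure (circleMeasure s) := by
  unfold circleMeasure
  infer_instance

instance isFiniteMeasure_boundaryMeasure (q : ℝ) : IsFiniteMeasure (boundaryMeasure q) := by
  unfold boundaryMeasure
  infer_instance

/-- The circles are separated by the value of `‖z‖`, and `angle` inverts each parametrization.
Measurable representatives make the glued function measurable on `ℂ`. -/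
lemma exists_Lp_circle_eq {q B : ℝ} (hq0 : 0 < q) (hq1 : q < 1) {f₁ f₂ : ℝ → ℂ}
    (hm₁ : AEStronglyMeasurable f₁ angleMeasure) (hm₂ : AEStronglyMeasurable f₂ angleMeasure)
    (hB₁ : ∀ᵐ t ∂angleMeasure, ‖f₁ t‖ ≤ B) (hB₂ : ∀ᵐ t ∂angleMeasure, ‖f₂ t‖ ≤ B) :
    ∃ u : Lp ℂ 2 (boundaryMeasure q), (∀ᵐ t ∂angleMeasure, u (circleMap 0 1 t) = f₁ t) ∧
      ∀ᵐ t ∂angleMeasure, u (circleMap 0 q t) = f₂ t := by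
  set f : ℂ → ℂ := fun z => if ‖z‖ = 1 then hm₁.mk f₁ (angle z) else hm₂.mk f₂ (angle z) with hf
  have hfm : Measurable f :=
    Measurable.ite (measurableSet_eq_fun measurable_norm measurable_const)
      (hm₁.stronglyMeasurable_mk.measurable.comp measurable_angle)
      (hm₂.stronglyMeasurable_mk.measurable.comp measurable_angle)
  have e1 : ∀ᵐ t ∂angleMeasure, f (circleMap 0 1 t) = f₁ t := by
    filter_upwards [hm₁.ae_eq_mk, ae_restrict_mem measurableSet_Ioc] with t h1 h2
    simp only [hf]
    rw [if_pos (by simp), angle_circleMap one_pos h2, h1]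
  have e2 : ∀ᵐ t ∂angleMeasure, f (circleMap 0 q t) = f₂ t := by
    filter_upwards [hm₂.ae_eq_mk, ae_restrict_mem measurableSet_Ioc] with t h1 h2
    simp only [hf]
    rw [if_neg (by simp [abs_of_pos hq0, hq1.ne]), angle_circleMap hq0 h2, h1]
  have hmeas : MeasurableSet {z | ‖f z‖ ≤ B} := measurableSet_le hfm.norm measurable_const
  have hfB : ∀ᵐ z ∂boundaryMeasure q, ‖f z‖ ≤ B := by
    rw [boundaryMeasure, ae_add_measure_iff]
    constructor
    · rw [circleMeasure, ae_map_iff (continuous_circleMap 0 1).aemeasurable hmeas]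
      filter_upwards [e1, hB₁] with t h1 h2
      rwa [h1]
    · rw [circleMeasure, ae_map_iff (continuous_circleMap 0 q).aemeasurable hmeas]
      filter_upwards [e2, hB₂] with t h1 h2
      rwa [h1]
  have hL : MemLp f 2 (boundaryMeasure q) := MemLp.of_bound hfm.aestronglyMeasurable B hfB
  refine ⟨hL.toLp f, ?_, ?_⟩
  · filter_upwards [e1, ae_circle (circleMeasure_one_le q) hL.coeFn_toLp] with t h1 h2
    rw [h2, h1]
  · filter_upwards [e2, ae_circle (circleMeasure_le q) hL.coeFn_toLp] with t h1 h2
    rw [h2, h1]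

/-- One turn adds `2πi` to `log r + i t`, so the exponential contributes the factor `exp (2πiκ)`,
while `H` is periodic. The values `γ = 1` and `γ = -1` serve the outer function and its reciprocal.
-/
lemma isAutomorphic_mul_exp {q α β κ : ℝ} (γ : ℝ) {G H : ℝ × ℝ → ℂ}
    (hG : IsAutomorphic q α G)
    (hH : IsAutomorphic q 0 H) (hκ : ∃ k : ℤ, β = α + κ + k) :
    IsAutomorphic q β fun p => G p *
      Complex.exp (γ * H p + κ * (Real.log p.1 + p.2 * Complex.I)) where
  analytic := by
    refine hG.analytic.mul (DifferentiableOn.cexp ((hH.analytic.const_mul _).add ?_))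
    simp only [Real.log_exp, Complex.re_add_im]
    exact (by fun_prop : Differentiable ℂ fun w : ℂ => (κ : ℂ) * w).differentiableOn
  index := by
    intro r t h1 h2
    obtain ⟨k, rfl⟩ := hκ
    have e0 : H (r, t + 2 * Real.pi) = H (r, t) := by
      rw [hH.index r t h1 h2]
      simp
    simp only
    rw [hG.index r t h1 h2, e0]
    have e : Complex.exp (γ * H (r, t) + κ * (Real.log r + (t + 2 * Real.pi : ℝ) * Complex.I)) =
        Complex.exp (2 * Real.pi * Complex.I * κ) *
          Complex.exp (γ * H (r, t) + κ * (Real.log r + t * Complex.I)) := by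
      rw [← Complex.exp_add]
      congr 1
      push_cast
      ring
    have e2 : Complex.exp (2 * Real.pi * Complex.I * ((α + κ + k : ℝ) : ℂ)) =
        Complex.exp (2 * Real.pi * Complex.I * α) * Complex.exp (2 * Real.pi * Complex.I * κ) := by
      rw [← Complex.exp_add, Complex.exp_eq_exp_iff_exists_int]
      exact ⟨k, by push_cast; ring⟩
    rw [e, e2]
    ring

lemma coef_zero_zero (f : ℝ → ℂ) :
    coef 0 f 0 = (1 / (2 * Real.pi) : ℝ) • ∫ t, f t ∂angleMeasure := by
  rw [coef_eq]
  simp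

/-- For bounded data `v₁`, `v₂` whose means differ by `κ log q`, there is a bounded function with
bounded reciprocal in the Hardy space of index `κ` modulo `1` whose modulus is `exp v₁` and
`exp v₂` on the two boundary circles. Quotients of Hardy functions by it have the same mean on the
two circles. -/
theorem exists_outer {q α K κ : ℝ} (hq0 : 0 < q) (hq1 : q < 1) {v₁ v₂ : ℝ → ℝ}
    (hm₁ : AEStronglyMeasurable v₁ angleMeasure) (hm₂ : AEStronglyMeasurable v₂ angleMeasure)
    (hK₁ : ∀ᵐ t ∂angleMeasure, |v₁ t| ≤ K) (hK₂ : ∀ᵐ t ∂angleMeasure, |v₂ t| ≤ K)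
    (hmean : ∫ t, v₂ t ∂angleMeasure - ∫ t, v₁ t ∂angleMeasure = 2 * Real.pi * (κ * Real.log q))
    (hκ : ∃ k : ℤ, κ = α + k) :
    ∃ u ∈ hardySpace q α hq0 hq1,
      (∀ᵐ t ∂angleMeasure, ‖u (circleMap 0 1 t)‖ = Real.exp (v₁ t)) ∧
      (∀ᵐ t ∂angleMeasure, ‖u (circleMap 0 q t)‖ = Real.exp (v₂ t)) ∧
      ∀ g ∈ hardySpace q α hq0 hq1,
        ∫ t, g (circleMap 0 1 t) / u (circleMap 0 1 t) ∂angleMeasure =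
          ∫ t, g (circleMap 0 q t) / u (circleMap 0 q t) ∂angleMeasure := by
  set K' := K + |κ * Real.log q|
  have hK₁' : ∀ᵐ t ∂angleMeasure, |v₁ t| ≤ K' := by
    filter_upwards [hK₁] with t ht
    linarith [abs_nonneg (κ * Real.log q)]
  have hK₂' : ∀ᵐ t ∂angleMeasure, |v₂ t - κ * Real.log q| ≤ K' := by
    filter_upwards [hK₂] with t ht
    exact (abs_sub _ _).trans (by linarith)
  have hi₂ : Integrable v₂ angleMeasure := Integrable.of_bound hm₂ K hK₂
  obtain ⟨k, hk⟩ := hκ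
  -- Subtracting `κ log q` from the inner data equalises the means. The factor `exp (κ w)`, of
  -- modulus `q ^ κ` on `|z| = q` and `1` on `|z| = 1`, restores it.
  obtain ⟨H, h₁, h₂, C, hH, hh₁, hh₂, hC, ht₁, ht₂, hre₁, hre₂⟩ :=
    exists_automorphic_re_eq hq0 hq1 hm₁ (hm₂.sub aestronglyMeasurable_const) hK₁' hK₂' (by
      rw [coef_zero_zero, coef_zero_zero, integral_complex_ofReal, integral_complex_ofReal]
      congr 2
      simp only [Pi.sub_apply]
      rw [integral_sub hi₂ (integrable_const _), integral_const]
      have : angleMeasure.real univ = 2 * Real.pi := by simp [Measure.real, Real.pi_pos.le]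
      rw [this, smul_eq_mul]
      linarith)
  set f₁ : ℝ → ℂ := fun t => Complex.exp (h₁ t + κ * (Real.log 1 + t * Complex.I)) with hf₁
  set f₂ : ℝ → ℂ := fun t => Complex.exp (h₂ t + κ * (Real.log q + t * Complex.I)) with hf₂
  have hn₁ : ∀ᵐ t ∂angleMeasure, ‖f₁ t‖ = Real.exp (v₁ t) := by
    filter_upwards [hre₁] with t ht
    rw [hf₁, norm_exp_add_mul, ht]
    simp
  have hn₂ : ∀ᵐ t ∂angleMeasure, ‖f₂ t‖ = Real.exp (v₂ t) := by
    filter_upwards [hre₂] with t ht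
    rw [hf₂, norm_exp_add_mul, ht]
    simp
  have hfm₁ : AEStronglyMeasurable f₁ angleMeasure :=
    Complex.continuous_exp.comp_aestronglyMeasurable
      (hh₁.1.add (Continuous.aestronglyMeasurable (by fun_prop)))
  have hfm₂ : AEStronglyMeasurable f₂ angleMeasure :=
    Complex.continuous_exp.comp_aestronglyMeasurable
      (hh₂.1.add (Continuous.aestronglyMeasurable (by fun_prop)))
  obtain ⟨u, hu₁, hu₂⟩ := exists_Lp_circle_eq (q := q) (B := Real.exp K) hq0 hq1 hfm₁ hfm₂
    (by filter_upwards [hn₁, hK₁] with t h1 h2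
        rw [h1, Real.exp_le_exp]
        exact (le_abs_self _).trans h2)
    (by filter_upwards [hn₂, hK₂] with t h1 h2
        rw [h1, Real.exp_le_exp]
        exact (le_abs_self _).trans h2)
  have hHc : ∀ r ∈ Ioo q 1, Continuous fun t => H (r, t) := fun r hr =>
    continuous_slice hH hq0 hr.1 hr.2
  have hmem1 : ∀ᶠ r in 𝓝[<] (1 : ℝ), r ∈ Ioo q 1 := Ioo_mem_nhdsLT hq1
  have hmemq : ∀ᶠ r in 𝓝[>] q, r ∈ Ioo q 1 := Ioo_mem_nhdsGT hq1
  have hconst : MemLp (fun _ : ℝ => (1 : ℂ)) 2 angleMeasure := memLp_const 1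
  have hone : IsAutomorphic q 0 fun _ => (1 : ℂ) :=
    ⟨differentiableOn_const 1, fun _ _ _ _ => by simp⟩
  have hF := isAutomorphic_mul_exp (β := α) (κ := κ) 1 hone hH
    ⟨-k, by rw [hk]; push_cast; ring⟩
  refine ⟨u, ⟨_, hF, ?_, ?_⟩, ?_, ?_, ?_⟩
  · have := tendsto_eLpNorm_mul_exp (κ := κ) hq0 hq1 (s := 1) ⟨hq1.le, le_rfl⟩ nhdsWithin_le_nhds
      hmem1 hHc hC hh₁ ht₁ (G := fun _ => 1) (g := fun _ => 1)
      (Eventually.of_forall fun _ => hconst) hconst (by simp)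
    refine this.congr fun r => eLpNorm_congr_ae ?_
    filter_upwards [hu₁] with t ht
    rw [ht]
    simp [hf₁]
  · have := tendsto_eLpNorm_mul_exp (κ := κ) hq0 hq1 (s := q) ⟨le_rfl, hq1.le⟩ nhdsWithin_le_nhds
      hmemq hHc hC hh₂ ht₂ (G := fun _ => 1) (g := fun _ => 1)
      (Eventually.of_forall fun _ => hconst) hconst (by simp)
    refine this.congr fun r => eLpNorm_congr_ae ?_
    filter_upwards [hu₂] with t ht
    rw [ht]
    simp [hf₂]
  · filter_upwards [hu₁, hn₁] with t h1 h2
    rw [h1, h2]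
  · filter_upwards [hu₂, hn₂] with t h1 h2
    rw [h1, h2]
  · rintro g ⟨G, hG, hG₁, hG₂⟩
    -- The quotient `g / u` extends to the annulus as `G exp (-H - κ w)`. Its index `α - κ` is an
    -- integer, so the extension is single valued.
    have hQ := isAutomorphic_mul_exp (β := 0) (κ := -κ) (-1) hG hH
      ⟨k, by rw [hk]; ring⟩
    set Q : ℝ × ℝ → ℂ := fun p => G p *
      Complex.exp (((-1 : ℝ) : ℂ) * H p + ((-κ : ℝ) : ℂ) * (Real.log p.1 + p.2 * Complex.I)) with hQdef
    have hgm₁ := memLp_circle (circleMeasure_one_le q) g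
    have hgm₂ := memLp_circle (circleMeasure_le q) g
    have neg_sub_eq : ∀ (r : ℝ) (h : ℝ → ℂ), (fun t => -H (r, t) - -h t) =
        -(fun t => H (r, t) - h t) := by
      intro r h
      ext t
      simp
      ring
    have hHc' : ∀ r ∈ Ioo q 1, Continuous fun t => -H (r, t) := fun r hr => (hHc r hr).neg
    have hC' : ∀ r ∈ Ioo q 1, ∀ t, |(-H (r, t)).re| ≤ C := fun r hr t => by
      simpa using hC r hr t
    have l1 := tendsto_eLpNorm_mul_exp (κ := -κ) hq0 hq1 (s := 1) ⟨hq1.le, le_rfl⟩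
      nhdsWithin_le_nhds hmem1 (H := fun p => -H p) hHc' hC' hh₁.neg
      (by simpa only [Pi.neg_apply, neg_sub_eq, eLpNorm_neg] using ht₁)
      (eventually_slice_one hG hq0 hq1) hgm₁ hG₁
    have l2 := tendsto_eLpNorm_mul_exp (κ := -κ) hq0 hq1 (s := q) ⟨le_rfl, hq1.le⟩
      nhdsWithin_le_nhds hmemq (H := fun p => -H p) hHc' hC' hh₂.neg
      (by simpa only [Pi.neg_apply, neg_sub_eq, eLpNorm_neg] using ht₂)
      (eventually_slice hG hq0 hq1) hgm₂ hG₂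
    have quot : ∀ (s : ℝ) (f h : ℝ → ℂ),
        (f = fun t => Complex.exp (h t + κ * (Real.log s + t * Complex.I))) →
        (∀ᵐ t ∂angleMeasure, u (circleMap 0 s t) = f t) →
        (fun t => g (circleMap 0 s t) / u (circleMap 0 s t)) =ᵐ[angleMeasure] fun t =>
          g (circleMap 0 s t) *
            Complex.exp ((-h) t + ((-κ : ℝ) : ℂ) * (Real.log s + t * Complex.I)) := by
      rintro s f h rfl hs
      filter_upwards [hs] with t ht
      rw [ht, div_eq_mul_inv, ← Complex.exp_neg]
      congr 2
      simp
      ring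
    have quotm : ∀ (s B : ℝ) (f : ℝ → ℂ) (v : ℝ → ℝ), MemLp (fun t => g (circleMap 0 s t)) 2 angleMeasure →
        AEStronglyMeasurable f angleMeasure → (∀ᵐ t ∂angleMeasure, u (circleMap 0 s t) = f t) →
        (∀ᵐ t ∂angleMeasure, ‖f t‖ = Real.exp (v t)) → (∀ᵐ t ∂angleMeasure, |v t| ≤ B) →
        MemLp (fun t => g (circleMap 0 s t) / u (circleMap 0 s t)) 2 angleMeasure := by
      intro s B f v h1 h2 h3 h4 h5
      refine (h1.const_smul (Real.exp B)).of_le ?_ ?_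
      · refine AEStronglyMeasurable.congr (h1.1.mul h2.inv₀) ?_
        filter_upwards [h3] with t ht
        simp [ht, div_eq_mul_inv]
      · filter_upwards [h3, h4, h5] with t h3 h4 h5
        rw [norm_div, h3, h4, Pi.smul_apply, norm_smul, Real.norm_of_nonneg (Real.exp_pos _).le,
          div_eq_inv_mul, ← Real.exp_neg]
        gcongr
        linarith [neg_abs_le (v t)]
    have qm₁ := quotm 1 K f₁ v₁ hgm₁ hfm₁ hu₁ hn₁ hK₁
    have qm₂ := quotm q K f₂ v₂ hgm₂ hfm₂ hu₂ hn₂ hK₂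
    have c1 := coef_tendsto 0 (eventually_slice_one hQ hq0 hq1) qm₁ (by
      refine l1.congr fun r => eLpNorm_congr_ae ?_
      filter_upwards [quot 1 f₁ h₁ rfl hu₁] with t ht
      rw [ht]
      simp [hQdef]) 0
    have c2 := coef_tendsto 0 (eventually_slice hQ hq0 hq1) qm₂ (by
      refine l2.congr fun r => eLpNorm_congr_ae ?_
      filter_upwards [quot q f₂ h₂ rfl hu₂] with t ht
      rw [ht]
      simp [hQdef]) 0
    -- The zeroth coefficient does not depend on the radius, so both boundary means equal its value
    -- at an intermediate radius.
    obtain ⟨ρ, hρ⟩ := exists_between hq1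
    have hcs : ∀ r ∈ Ioo q 1, coef 0 (fun t => Q (r, t)) 0 = coef 0 (fun t => Q (ρ, t)) 0 := by
      intro r hr
      have := coef_slice hQ hq0 0 hr (s := ρ) hρ
      simpa using this
    have d1 := tendsto_nhds_unique_of_eventuallyEq c1
      (tendsto_const_nhds (x := coef 0 (fun t => Q (ρ, t)) 0)) (hmem1.mono hcs)
    have d2 := tendsto_nhds_unique_of_eventuallyEq c2
      (tendsto_const_nhds (x := coef 0 (fun t => Q (ρ, t)) 0)) (hmemq.mono hcs)
    have d := d1.trans d2.symm
    rw [coef_zero_zero, coef_zero_zero] at d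
    have hpi := Real.pi_pos
    exact smul_right_injective ℂ (by positivity : (1 / (2 * Real.pi) : ℝ) ≠ 0) d

/-! ### From the period condition to an eigenvector. -/

lemma exists_ae_abs_le {q : ℝ} {φ : ℂ → ℝ} (hφ : MemLp φ ∞ (boundaryMeasure q)) :
    ∃ N : ℝ, ∀ᵐ z ∂boundaryMeasure q, |φ z| ≤ N := by
  refine ⟨(eLpNorm φ ∞ (boundaryMeasure q)).toReal, ?_⟩
  have h := ae_le_eLpNormEssSup (f := φ) (μ := boundaryMeasure q)
  filter_upwards [h] with z hz
  rw [← eLpNorm_exponent_top] at hz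
  have := ENNReal.toReal_mono hφ.2.ne hz
  simpa using this

lemma aestronglyMeasurable_circle {q s : ℝ} (hs : circleMeasure s ≤ boundaryMeasure q)
    {E : Type*} [TopologicalSpace E] {φ : ℂ → E} (hφ : AEStronglyMeasurable φ (boundaryMeasure q)) :
    AEStronglyMeasurable (fun t => φ (circleMap 0 s t)) angleMeasure :=
  (hφ.mono_measure hs).comp_aemeasurable (continuous_circleMap 0 s).aemeasurable

lemma integral_boundaryMeasure {q : ℝ} {f : ℂ → ℂ} (hf : Integrable f (boundaryMeasure q)) :
    ∫ z, f z ∂boundaryMeasure q =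
      ∫ t, f (circleMap 0 1 t) ∂angleMeasure + ∫ t, f (circleMap 0 q t) ∂angleMeasure := by
  have h1 := hf.mono_measure (circleMeasure_one_le q)
  have h2 := hf.mono_measure (circleMeasure_le q)
  rw [boundaryMeasure, integral_add_measure h1 h2, circleMeasure, circleMeasure,
    integral_map (continuous_circleMap 0 1).aemeasurable h1.1,
    integral_map (continuous_circleMap 0 q).aemeasurable h2.1]

lemma abs_log_le_of_mem_Icc {x a b : ℝ} (ha : 0 < a) (hax : a ≤ x) (hxb : x ≤ b) :
    |Real.log x| ≤ |Real.log a| + |Real.log b| := by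
  have h1 := Real.log_le_log ha hax
  have h2 := Real.log_le_log (ha.trans_le hax) hxb
  rw [abs_le]
  constructor
  · linarith [neg_abs_le (Real.log a), abs_nonneg (Real.log b)]
  · linarith [le_abs_self (Real.log b), abs_nonneg (Real.log a)]

/-- If `φ - l` is bounded away from zero, of opposite signs on the two boundary circles, and the
means of `log |φ - l|` on the circles satisfy the period condition, then `l` is an eigenvalue. -/
theorem hasEigenvalue_toeplitz {q α l σ δ κ : ℝ} (hq0 : 0 < q) (hq1 : q < 1) {φ : ℂ → ℝ}
    (hφ : MemLp φ ∞ (boundaryMeasure q)) (hσ : σ * σ = 1) (hδ : 0 < δ)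
    (h₁ : ∀ᵐ t ∂angleMeasure, δ ≤ σ * (φ (circleMap 0 1 t) - l))
    (h₂ : ∀ᵐ t ∂angleMeasure, δ ≤ σ * (l - φ (circleMap 0 q t)))
    (hlog : ∫ t, Real.log |φ (circleMap 0 1 t) - l| ∂angleMeasure -
      ∫ t, Real.log |φ (circleMap 0 q t) - l| ∂angleMeasure = 4 * Real.pi * Real.log q * κ)
    (hκ : ∃ k : ℤ, κ = α + k) :
    Module.End.HasEigenvalue (toeplitz q α hq0 hq1 φ hφ).toLinearMap (l : ℂ) := by
  obtain ⟨N, hN⟩ := exists_ae_abs_le hφ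
  have hσa : |σ| = 1 := by
    have := congrArg abs hσ
    rw [abs_mul, abs_one] at this
    nlinarith [abs_nonneg σ]
  have habs : ∀ x : ℝ, |σ * x| = |x| := fun x => by rw [abs_mul, hσa, one_mul]
  have hδ₁ : ∀ᵐ t ∂angleMeasure, δ ≤ |φ (circleMap 0 1 t) - l| := by
    filter_upwards [h₁] with t ht
    rw [← habs]
    exact ht.trans (le_abs_self _)
  have hδ₂ : ∀ᵐ t ∂angleMeasure, δ ≤ |φ (circleMap 0 q t) - l| := by
    filter_upwards [h₂] with t ht
    rw [← habs, ← abs_neg]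
    exact (le_of_le_of_eq ht (by ring)).trans (le_abs_self _)
  set K := |Real.log δ| + |Real.log (N + |l|)|
  -- The factor `-1/2` gives `|u|² = 1 / |φ - l|`; it also turns `4π log q` in the hypothesis into
  -- the `2π log q` of `exists_outer`.
  set v : ℝ → ℝ → ℝ := fun s t => -(1 / 2) * Real.log |φ (circleMap 0 s t) - l| with hv
  have hvm : ∀ s, circleMeasure s ≤ boundaryMeasure q → AEStronglyMeasurable (v s) angleMeasure := by
    intro s hs
    have := (aestronglyMeasurable_circle hs hφ.1).aemeasurable
    exact ((Real.measurable_log.comp_aemeasurable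
      (measurable_norm.comp_aemeasurable (this.sub_const l))).const_mul _).aestronglyMeasurable
  have hvK : ∀ s, circleMeasure s ≤ boundaryMeasure q →
      (∀ᵐ t ∂angleMeasure, δ ≤ |φ (circleMap 0 s t) - l|) →
      ∀ᵐ t ∂angleMeasure, |v s t| ≤ K := by
    intro s hs h
    filter_upwards [h, ae_circle hs hN] with t h1 h2
    have h3 := abs_log_le_of_mem_Icc hδ h1 ((abs_sub _ _).trans (add_le_add_left h2 _))
    rw [hv, abs_mul, show |(-(1 / 2) : ℝ)| = 1 / 2 by norm_num]
    linarith [abs_nonneg (Real.log |φ (circleMap 0 s t) - l|)]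
  obtain ⟨u, huH, hu₁, hu₂, hmean⟩ := exists_outer (α := α) (κ := κ) hq0 hq1
    (hvm 1 (circleMeasure_one_le q)) (hvm q (circleMeasure_le q))
    (hvK 1 (circleMeasure_one_le q) hδ₁) (hvK q (circleMeasure_le q) hδ₂)
    (by simp only [hv]
        rw [integral_const_mul, integral_const_mul]
        linear_combination (1 / 2) * hlog) hκ
  have hsq : ∀ s t, δ ≤ |φ (circleMap 0 s t) - l| → ‖u (circleMap 0 s t)‖ = Real.exp (v s t) →
      u (circleMap 0 s t) ≠ 0 ∧ |φ (circleMap 0 s t) - l| * ‖u (circleMap 0 s t)‖ ^ 2 = 1 := by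
    intro s t h1 h2
    constructor
    · rw [← norm_pos_iff, h2]
      exact Real.exp_pos _
    · rw [h2, ← Real.exp_nat_mul, hv]
      have : ((2 : ℕ) : ℝ) * (-(1 / 2) * Real.log |φ (circleMap 0 s t) - l|) =
        -Real.log |φ (circleMap 0 s t) - l| := by push_cast; ring
      rw [this, Real.exp_neg, Real.exp_log (hδ.trans_le h1)]
      exact mul_inv_cancel₀ (hδ.trans_le h1).ne'
  have hne : u ≠ 0 := by
    rintro rfl
    have h0 := ae_circle (circleMeasure_one_le q) (Lp.coeFn_zero ℂ 2 (boundaryMeasure q))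
    have hF : ∀ᵐ t ∂angleMeasure, False := by
      filter_upwards [h0, hu₁, hδ₁] with t h0 h1 h2
      exact (hsq 1 t h2 h1).1 h0
    rw [eventually_false_iff_eq_bot, ae_eq_bot] at hF
    have := congrArg (fun μ : Measure ℝ => μ univ) hF
    simp at this
    linarith [Real.pi_pos]
  have horth : ∀ w ∈ hardySpace q α hq0 hq1,
      inner ℂ (multiplication q φ hφ u - (l : ℂ) • u) w = 0 := by
    intro w hw
    set y := multiplication q φ hφ u - (l : ℂ) • u with hy
    have hyae : ∀ᵐ z ∂boundaryMeasure q, y z = ((φ z - l : ℝ) : ℂ) * u z := by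
      filter_upwards [Lp.coeFn_sub (multiplication q φ hφ u) ((l : ℂ) • u),
        multiplication_ae q φ hφ u, Lp.coeFn_smul (l : ℂ) u] with z h1 h2 h3
      rw [hy, h1, Pi.sub_apply, h2, h3, Pi.smul_apply, smul_eq_mul]
      push_cast
      ring
    rw [L2.inner_def, integral_boundaryMeasure (L2.integrable_inner y w)]
    have e₁ : ∫ t, inner ℂ (y (circleMap 0 1 t)) (w (circleMap 0 1 t)) ∂angleMeasure =
        (σ : ℂ) * ∫ t, w (circleMap 0 1 t) / u (circleMap 0 1 t) ∂angleMeasure := by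
      rw [← integral_const_mul]
      refine integral_congr_ae ?_
      filter_upwards [ae_circle (circleMeasure_one_le q) hyae, hu₁, hδ₁, h₁] with t a1 a2 a3 a4
      obtain ⟨n1, n2⟩ := hsq 1 t a3 a2
      have hs : |φ (circleMap 0 1 t) - l| = σ * (φ (circleMap 0 1 t) - l) := by
        rw [← habs, abs_of_nonneg (hδ.le.trans a4)]
      rw [hs] at n2
      -- Together with `σ² = 1` this is `(φ - l) ū = σ / u`; on the inner circle the sign is
      -- reversed.
      have n3 : (σ : ℂ) * ((φ (circleMap 0 1 t) - l : ℝ) : ℂ) *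
          (u (circleMap 0 1 t) * (starRingEnd ℂ) (u (circleMap 0 1 t))) = 1 := by
        rw [Complex.mul_conj']
        exact_mod_cast n2
      have n4 : (σ : ℂ) * σ = 1 := by exact_mod_cast hσ
      rw [a1, RCLike.inner_apply, map_mul, Complex.conj_ofReal]
      field_simp
      linear_combination (σ : ℂ) * w (circleMap 0 1 t) * n3 -
        w (circleMap 0 1 t) * ((φ (circleMap 0 1 t) - l : ℝ) : ℂ) *
          (u (circleMap 0 1 t) * (starRingEnd ℂ) (u (circleMap 0 1 t))) * n4
    have e₂ : ∫ t, inner ℂ (y (circleMap 0 q t)) (w (circleMap 0 q t)) ∂angleMeasure =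
        -(σ : ℂ) * ∫ t, w (circleMap 0 q t) / u (circleMap 0 q t) ∂angleMeasure := by
      rw [← integral_const_mul]
      refine integral_congr_ae ?_
      filter_upwards [ae_circle (circleMeasure_le q) hyae, hu₂, hδ₂, h₂] with t a1 a2 a3 a4
      obtain ⟨n1, n2⟩ := hsq q t a3 a2
      have hs : |φ (circleMap 0 q t) - l| = σ * (l - φ (circleMap 0 q t)) := by
        rw [abs_sub_comm, ← habs, abs_of_nonneg (hδ.le.trans a4)]
      rw [hs] at n2
      have n3 : -(σ : ℂ) * ((φ (circleMap 0 q t) - l : ℝ) : ℂ) *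
          (u (circleMap 0 q t) * (starRingEnd ℂ) (u (circleMap 0 q t))) = 1 := by
        rw [Complex.mul_conj']
        have : -σ * (φ (circleMap 0 q t) - l) * ‖u (circleMap 0 q t)‖ ^ 2 = 1 := by
          rw [← n2]; ring
        exact_mod_cast this
      have n4 : (σ : ℂ) * σ = 1 := by exact_mod_cast hσ
      rw [a1, RCLike.inner_apply, map_mul, Complex.conj_ofReal]
      field_simp
      linear_combination -(σ : ℂ) * w (circleMap 0 q t) * n3 -
        w (circleMap 0 q t) * ((φ (circleMap 0 q t) - l : ℝ) : ℂ) *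
          (u (circleMap 0 q t) * (starRingEnd ℂ) (u (circleMap 0 q t))) * n4
    rw [e₁, e₂, hmean w hw]
    ring
  refine Module.End.hasEigenvalue_of_hasEigenvector (x := ⟨u, huH⟩) ⟨?_, ?_⟩
  · rw [Module.End.mem_eigenspace_iff]
    refine Subtype.ext ?_
    -- Since `l u` lies in `H²_α` and `φ u - l u` is orthogonal to it, `l u` is the projection of `φ
    -- u`.
    exact Submodule.eq_starProjection_of_mem_of_inner_eq_zero
      (Submodule.smul_mem _ (l : ℂ) huH) horth
  · intro h
    exact hne (congrArg Subtype.val h)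

/-! ### Logarithmic integrals as functions of the spectral parameter. -/

lemma toENNReal_neg_log_of_ne {x c : ℝ} (h : x ≠ c) :
    (-ENNReal.log ‖x - c‖ₑ).toENNReal = ENNReal.ofReal (-Real.log |x - c|) := by
  have h1 : 0 < |x - c| := abs_pos.mpr (sub_ne_zero.mpr h)
  rw [← ofReal_norm, Real.norm_eq_abs, ENNReal.log_ofReal_of_pos h1, ← EReal.coe_neg,
    EReal.toENNReal_of_ne_top (EReal.coe_ne_top _), EReal.toReal_coe]

section

variable {X : Type*} [MeasurableSpace X] {μ : Measure X} {f g : X → ℝ}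
  {m M N : ℝ}

lemma aemeasurable_log_abs_sub (hf : AEMeasurable f μ) (l : ℝ) :
    AEMeasurable (fun x => Real.log |f x - l|) μ :=
  Real.measurable_log.comp_aemeasurable (measurable_norm.comp_aemeasurable (hf.sub_const l))

lemma ae_abs_log_le {l d R : ℝ} (hN : ∀ᵐ x ∂μ, |f x| ≤ N) (hd : 0 < d)
    (hsep : ∀ᵐ x ∂μ, d ≤ |f x - l|) (hl : |l| ≤ R) :
    ∀ᵐ x ∂μ, |Real.log (|f x - l|)| ≤ |Real.log d| + |Real.log (N + R)| := by
  filter_upwards [hN, hsep] with x h1 h2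
  exact abs_log_le_of_mem_Icc hd h2 ((abs_sub _ _).trans (by linarith))

lemma le_abs_sub_of_notMem {y l d : ℝ} (hy : y ∉ Ioo m M) (h1 : m + d ≤ l) (h2 : l + d ≤ M) :
    d ≤ |y - l| := by
  rw [le_abs]
  by_cases h : y ≤ m
  · right; linarith
  · left
    have : M ≤ y := by
      by_contra h3
      exact hy ⟨not_le.mp h, not_le.mp h3⟩
    linarith

variable [IsFiniteMeasure μ]

lemma integrable_log_abs_sub (hf : AEMeasurable f μ) (hN : ∀ᵐ x ∂μ, |f x| ≤ N)
    (hsep : ∀ᵐ x ∂μ, f x ∉ Ioo m M) {l : ℝ} (hl : l ∈ Ioo m M) :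
    Integrable (fun x => Real.log |f x - l|) μ := by
  have hd : 0 < min (l - m) (M - l) := lt_min (by linarith [hl.1]) (by linarith [hl.2])
  refine Integrable.of_bound (aemeasurable_log_abs_sub hf l).aestronglyMeasurable _
    (ae_abs_log_le hN hd ?_ le_rfl)
  filter_upwards [hsep] with x hx
  refine le_abs_sub_of_notMem hx ?_ ?_
  · linarith [min_le_left (l - m) (M - l)]
  · linarith [min_le_right (l - m) (M - l)]

lemma continuousOn_integral_log (hf : AEMeasurable f μ) (hN : ∀ᵐ x ∂μ, |f x| ≤ N)
    (hsep : ∀ᵐ x ∂μ, f x ∉ Ioo m M) :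
    ContinuousOn (fun l => ∫ x, Real.log |f x - l| ∂μ) (Ioo m M) := by
  intro l hl
  refine ContinuousAt.continuousWithinAt ?_
  -- With half the distance to the endpoints, every parameter within `d` of `l` is still at distance
  -- at least `d` from `m` and `M`, which gives a uniform dominating constant.
  set d := min (l - m) (M - l) / 2 with hd
  have hd0 : 0 < d := by
    have : 0 < min (l - m) (M - l) := lt_min (by linarith [hl.1]) (by linarith [hl.2])
    positivity
  have hd1 : 2 * d ≤ l - m := by linarith [min_le_left (l - m) (M - l)]
  have hd2 : 2 * d ≤ M - l := by linarith [min_le_right (l - m) (M - l)]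
  refine continuousAt_of_dominated (bound := fun _ => |Real.log d| + |Real.log (N + (|l| + d))|)
    (Eventually.of_forall fun k => (aemeasurable_log_abs_sub hf k).aestronglyMeasurable) ?_
    (integrable_const _) ?_
  · filter_upwards [Metric.ball_mem_nhds l hd0] with k hk
    rw [Metric.mem_ball, Real.dist_eq, abs_lt] at hk
    refine ae_abs_log_le hN hd0 ?_ ?_
    · filter_upwards [hsep] with x hx
      exact le_abs_sub_of_notMem hx (by linarith) (by linarith)
    · have h3 : |k - l| ≤ d := abs_le.mpr ⟨by linarith, by linarith⟩
      have := abs_add_le (k - l) l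
      rw [sub_add_cancel] at this
      linarith
  · filter_upwards [hsep] with x hx
    have h1 : d ≤ |f x - l| := le_abs_sub_of_notMem hx (by linarith) (by linarith)
    exact ContinuousAt.log (by fun_prop) (by linarith [abs_nonneg (f x - l)])

/-- Fatou's lemma applies to `C - log |f - l k|`, nonnegative for a suitable constant `C ≥ 0`. The
lower limit dominates the negative part of `log |f - M|`, which has infinite integral. -/
lemma tendsto_integral_log_atBot (hf : AEMeasurable f μ) (hN : ∀ᵐ x ∂μ, |f x| ≤ N)
    (hfM : ∀ᵐ x ∂μ, M ≤ f x) (hdiv : ∫⁻ x, (-ENNReal.log ‖f x - M‖ₑ).toENNReal ∂μ = ∞)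
    {l : ℕ → ℝ} (hl : ∀ k, l k ∈ Ioo m M) (hlM : Tendsto l atTop (𝓝 M)) :
    Tendsto (fun k => ∫ x, Real.log |f x - l k| ∂μ) atTop atBot := by
  have hsep : ∀ᵐ x ∂μ, f x ∉ Ioo m M := by
    filter_upwards [hfM] with x hx h using not_lt.mpr hx h.2
  set C := |Real.log (N + (|m| + |M|))| with hC
  have hup : ∀ k, ∀ᵐ x ∂μ, Real.log |f x - l k| ≤ C := by
    intro k
    filter_upwards [hN, hfM] with x h1 h2
    have h3 : 0 < |f x - l k| := abs_pos.mpr (sub_pos.mpr (by linarith [(hl k).2])).ne'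
    have h4 : |l k| ≤ |m| + |M| := by
      rw [abs_le]
      constructor
      · linarith [(hl k).1, neg_abs_le m, abs_nonneg M]
      · linarith [(hl k).2, le_abs_self M, abs_nonneg m]
    refine (Real.log_le_log h3 ((abs_sub _ _).trans (add_le_add h1 h4))).trans (le_abs_self _)
  set F : ℕ → X → ℝ≥0∞ := fun k x => ENNReal.ofReal (C - Real.log |f x - l k|) with hF
  have hFm : ∀ k, AEMeasurable (F k) μ := fun k =>
    ((aemeasurable_log_abs_sub hf (l k)).const_sub C).ennreal_ofReal
  have hpt : ∀ᵐ x ∂μ, (-ENNReal.log ‖f x - M‖ₑ).toENNReal ≤ liminf (fun k => F k x) atTop := by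
    filter_upwards [hfM] with x hx
    have hsub : Tendsto (fun k => |f x - l k|) atTop (𝓝 |f x - M|) := (hlM.const_sub (f x)).abs
    -- Where `f x = M` the extended logarithm is `-∞` but `Real.log 0 = 0`, so the divergence must
    -- come from the approach to zero.
    rcases eq_or_ne (f x) M with h | h
    · have hT : Tendsto (fun k => F k x) atTop (𝓝 ∞) := by
        refine ENNReal.tendsto_ofReal_nhds_top.mpr ?_
        have h0 : Tendsto (fun k => Real.log |f x - l k|) atTop atBot := by
          refine Real.tendsto_log_nhdsGT_zero.comp (tendsto_nhdsWithin_iff.mpr ⟨?_, ?_⟩)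
          · simpa [h] using hsub
          · refine Eventually.of_forall fun k => ?_
            have hk : l k < f x := (hl k).2.trans_le hx
            exact abs_pos.mpr (sub_pos.mpr hk).ne'
        exact tendsto_atTop_add_const_left _ C (tendsto_neg_atBot_atTop.comp h0)
      rw [hT.liminf_eq]
      exact le_top
    · have hne : |f x - M| ≠ 0 := abs_ne_zero.mpr (sub_ne_zero.mpr h)
      have hT : Tendsto (fun k => F k x) atTop (𝓝 (ENNReal.ofReal (C - Real.log |f x - M|))) :=
        ENNReal.tendsto_ofReal ((hsub.log hne).const_sub C)
      rw [hT.liminf_eq, toENNReal_neg_log_of_ne h]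
      refine ENNReal.ofReal_le_ofReal ?_
      linarith [abs_nonneg (Real.log (N + (|m| + |M|)))]
  have htop : liminf (fun k => ∫⁻ x, F k x ∂μ) atTop = ∞ := by
    have h1 := (lintegral_mono_ae hpt).trans (lintegral_liminf_le' hFm)
    rw [hdiv] at h1
    exact top_le_iff.mp h1
  refine tendsto_atBot.mpr fun b => ?_
  -- An integral of `C - log |f - l k|` above this threshold means an integral of the logarithm
  -- below `b`.
  have hlt := eventually_lt_of_lt_liminf (b := ENNReal.ofReal (μ.real univ * C - b))
    (f := atTop) (u := fun k => ∫⁻ x, F k x ∂μ) (by rw [htop]; exact ENNReal.ofReal_lt_top)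
  filter_upwards [hlt] with k hk
  have hi := integrable_log_abs_sub hf hN hsep (hl k)
  have hi2 : Integrable (fun x => C - Real.log |f x - l k|) μ := (integrable_const C).sub hi
  rw [hF, ← ofReal_integral_eq_lintegral_ofReal hi2
    (by filter_upwards [hup k] with x hx using sub_nonneg.mpr hx)] at hk
  have h2 := (ENNReal.ofReal_lt_ofReal_iff').mp hk
  rw [integral_sub (integrable_const C) hi, integral_const, smul_eq_mul] at h2
  linarith [h2.1]

/-- As `l` increases to `M` the integral for `f` tends to `-∞`, while that for `g` stays bounded
below because `g` remains at distance at least `(M - m) / 2` from `l`. The intermediate value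
theorem fills the half-line. -/
lemma exists_Iic_subset_image (hmM : m < M) (hf : AEMeasurable f μ) (hg : AEMeasurable g μ)
    (hNf : ∀ᵐ x ∂μ, |f x| ≤ N) (hNg : ∀ᵐ x ∂μ, |g x| ≤ N)
    (hfM : ∀ᵐ x ∂μ, M ≤ f x) (hgm : ∀ᵐ x ∂μ, g x ≤ m)
    (hdiv : ∫⁻ x, (-ENNReal.log ‖f x - M‖ₑ).toENNReal ∂μ = ∞) :
    ∃ y₀, Iic y₀ ⊆ (fun l => ∫ x, Real.log |f x - l| ∂μ - ∫ x, Real.log |g x - l| ∂μ) ''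
      Ioo m M := by
  have hsf : ∀ᵐ x ∂μ, f x ∉ Ioo m M := by
    filter_upwards [hfM] with x hx h using not_lt.mpr hx h.2
  have hsg : ∀ᵐ x ∂μ, g x ∉ Ioo m M := by
    filter_upwards [hgm] with x hx h using not_lt.mpr hx h.1
  set D := fun l => ∫ x, Real.log |f x - l| ∂μ - ∫ x, Real.log |g x - l| ∂μ with hD
  have hDc : ContinuousOn D (Ioo m M) :=
    (continuousOn_integral_log hf hNf hsf).sub (continuousOn_integral_log hg hNg hsg)
  -- The sequence starts at the midpoint of `(m, M)` and never goes below it, which gives the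
  -- distance to `g`.
  set l : ℕ → ℝ := fun k => M - (M - m) / 2 * (1 / ((k : ℝ) + 1)) with hl
  have hk1 : ∀ k : ℕ, 0 < 1 / ((k : ℝ) + 1) ∧ 1 / ((k : ℝ) + 1) ≤ 1 := fun k =>
    ⟨by positivity, by rw [div_le_one (by positivity)]; linarith [(Nat.cast_nonneg k : (0 : ℝ) ≤ k)]⟩
  have hlmid : ∀ k, (m + M) / 2 ≤ l k ∧ l k < M := by
    intro k
    obtain ⟨h1, h2⟩ := hk1 k
    simp only [hl]
    constructor <;> nlinarith
  have hlI : ∀ k, l k ∈ Ioo m M := fun k => ⟨by linarith [(hlmid k).1], (hlmid k).2⟩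
  have hlM : Tendsto l atTop (𝓝 M) := by
    have := (tendsto_one_div_add_atTop_nhds_zero_nat (𝕜 := ℝ)).const_mul ((M - m) / 2)
    simpa [hl] using this.const_sub M
  have hT := tendsto_integral_log_atBot hf hNf hfM hdiv hlI hlM
  set c := (M - m) / 2 with hc
  have hc0 : 0 < c := by rw [hc]; linarith
  have hlow : ∀ k, μ.real univ * Real.log c ≤ ∫ x, Real.log |g x - l k| ∂μ := by
    intro k
    have h1 : ∫ _, Real.log c ∂μ ≤ ∫ x, Real.log |g x - l k| ∂μ := by
      refine integral_mono_ae (integrable_const _) (integrable_log_abs_sub hg hNg hsg (hlI k)) ?_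
      filter_upwards [hgm] with x hx
      refine Real.log_le_log hc0 ?_
      rw [le_abs]
      right
      linarith [(hlmid k).1]
    simpa using h1
  refine ⟨D (l 0), fun y hy => ?_⟩
  obtain ⟨k, hk⟩ := (hT.eventually (eventually_le_atBot (y + μ.real univ * Real.log c))).exists
  have hDk : D (l k) ≤ y := by
    simp only [hD]
    linarith [hlow k]
  exact isPreconnected_Ioo.intermediate_value (hlI k) (hlI 0) hDc ⟨hDk, hy⟩

/-- On a finite set of solutions `D` would be bounded below, but the progression has terms below any
bound, and those below `y₀` are attained. -/
lemma infinite_setOf_eq_mul_add_int {D : ℝ → ℝ} {I : Set ℝ} {y₀ : ℝ} (h : Iic y₀ ⊆ D '' I) {c : ℝ}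
    (hc : c ≠ 0) (α : ℝ) : {l | l ∈ I ∧ ∃ k : ℤ, D l = c * (α + k)}.Infinite := by
  intro hfin
  have hb := (hfin.image D).bddBelow
  obtain ⟨b, hb⟩ := hb
  obtain ⟨n, hn⟩ := exists_nat_gt ((|c * α| + |y₀| + |b|) / |c|)
  have hc' : 0 < |c| := abs_pos.mpr hc
  rw [div_lt_iff₀ hc'] at hn
  -- The sign of `k` is opposite to that of `c`, so the progression is followed downwards.
  obtain ⟨k, hk⟩ : ∃ k : ℤ, c * k = -(n * |c|) := by
    rcases lt_or_gt_of_ne hc with h0 | h0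
    · exact ⟨n, by rw [abs_of_neg h0]; push_cast; ring⟩
    · exact ⟨-n, by rw [abs_of_pos h0]; push_cast; ring⟩
  have e : c * (α + k) = c * α - n * |c| := by rw [mul_add, hk]; ring
  obtain ⟨l, hl, hDl⟩ := h (show c * (α + k) ∈ Iic y₀ by
    rw [mem_Iic, e]
    linarith [le_abs_self (c * α), neg_abs_le y₀, abs_nonneg b])
  have := hb (mem_image_of_mem D (show l ∈ {l | l ∈ I ∧ ∃ k : ℤ, D l = c * (α + k)} from
    ⟨hl, k, hDl⟩))
  rw [hDl, e] at this
  linarith [le_abs_self (c * α), neg_abs_le b, abs_nonneg y₀]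

/-- If `g ≤ m < M ≤ f` and one of `log |f - M|`, `log |g - m|` has integral `-∞`, then the
difference of the integrals of `log |f - l|` and `log |g - l|` meets every nontrivial arithmetic
progression infinitely often for `l ∈ (m, M)`. -/
theorem infinite_setOf_integral_log_sub_eq (hmM : m < M) (hf : AEMeasurable f μ)
    (hg : AEMeasurable g μ) (hNf : ∀ᵐ x ∂μ, |f x| ≤ N) (hNg : ∀ᵐ x ∂μ, |g x| ≤ N)
    (hfM : ∀ᵐ x ∂μ, M ≤ f x) (hgm : ∀ᵐ x ∂μ, g x ≤ m)
    (hdiv : ∫⁻ x, (-ENNReal.log ‖f x - M‖ₑ).toENNReal ∂μ = ∞ ∨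
      ∫⁻ x, (-ENNReal.log ‖g x - m‖ₑ).toENNReal ∂μ = ∞) {c : ℝ} (hc : c ≠ 0) (α : ℝ) :
    {l | l ∈ Ioo m M ∧ ∃ k : ℤ, ∫ x, Real.log |f x - l| ∂μ - ∫ x, Real.log |g x - l| ∂μ =
      c * (α + k)}.Infinite := by
  rcases hdiv with hdiv | hdiv
  · obtain ⟨y₀, hy₀⟩ := exists_Iic_subset_image hmM hf hg hNf hNg hfM hgm hdiv
    exact infinite_setOf_eq_mul_add_int hy₀ hc α
  -- The substitution `(f, g, m, M, l) ↦ (-g, -f, -M, -m, -l)` moves the divergence at `m` to the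
  -- upper endpoint. It reverses the difference of integrals, hence the progression with `-c` below.
  · obtain ⟨y₀, hy₀⟩ := exists_Iic_subset_image (μ := μ) (f := fun x => -g x) (g := fun x => -f x)
      (m := -M) (M := -m) (N := N) (by linarith) hg.neg hf.neg (by simpa using hNg)
      (by simpa using hNf) (by simpa using hgm) (by simpa using hfM) (by
        rw [← hdiv]
        refine lintegral_congr fun x => ?_
        rw [← enorm_neg]
        congr 4
        ring)
    have hneg : ∀ a b : ℝ, |-a - -b| = |a - b| := fun a b => by rw [← abs_neg]; congr 1; ring
    refine infinite_setOf_eq_mul_add_int (D := fun l =>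
      ∫ x, Real.log |g x - l| ∂μ - ∫ x, Real.log |f x - l| ∂μ) (I := Ioo m M) (y₀ := y₀) ?_
      (neg_ne_zero.mpr hc) α |>.mono ?_
    · intro y hy
      obtain ⟨l, hl, hly⟩ := hy₀ hy
      refine ⟨-l, ⟨by linarith [hl.2], by linarith [hl.1]⟩, ?_⟩
      rw [← hly]
      simp only
      congr 2 <;> ext x <;> rw [← hneg, neg_neg]
    · rintro l ⟨hl, k, hk⟩
      exact ⟨hl, k, by linarith⟩

end

/-! ### Passing from the boundary to its two circles, and the conclusion. -/

lemma lintegral_boundaryMeasure {q : ℝ} {f : ℂ → ℝ≥0∞} (hf : AEMeasurable f (boundaryMeasure q)) :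
    ∫⁻ z, f z ∂boundaryMeasure q =
      ∫⁻ t, f (circleMap 0 1 t) ∂angleMeasure + ∫⁻ t, f (circleMap 0 q t) ∂angleMeasure := by
  have h1 := hf.mono_measure (circleMeasure_one_le q)
  have h2 := hf.mono_measure (circleMeasure_le q)
  rw [boundaryMeasure, lintegral_add_measure]
  rw [circleMeasure] at h1 h2 ⊢
  rw [circleMeasure, lintegral_map' h1 (continuous_circleMap 0 1).aemeasurable,
    lintegral_map' h2 (continuous_circleMap 0 q).aemeasurable]

lemma LogIntegralEqBot.lintegral_add_eq_top {q c : ℝ} {φ : ℂ → ℝ}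
    (hφ : AEMeasurable φ (boundaryMeasure q)) (h : LogIntegralEqBot q φ c) :
    ∫⁻ t, (-ENNReal.log ‖φ (circleMap 0 1 t) - c‖ₑ).toENNReal ∂angleMeasure +
      ∫⁻ t, (-ENNReal.log ‖φ (circleMap 0 q t) - c‖ₑ).toENNReal ∂angleMeasure = ∞ := by
  rw [← h.2, lintegral_boundaryMeasure]
  exact measurable_ereal_toENNReal.comp_aemeasurable (continuous_neg.measurable.comp_aemeasurable
    (ENNReal.log_monotone.measurable.comp_aemeasurable (hφ.sub_const c).enorm))

lemma lintegral_neg_log_ne_top {X : Type*} [MeasurableSpace X] {μ : Measure X} [IsFiniteMeasure μ]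
    {f : X → ℝ} {c d : ℝ} (hd : 0 < d) (h : ∀ᵐ x ∂μ, d ≤ |f x - c|) :
    ∫⁻ x, (-ENNReal.log ‖f x - c‖ₑ).toENNReal ∂μ ≠ ∞ := by
  have h1 : ∫⁻ x, (-ENNReal.log ‖f x - c‖ₑ).toENNReal ∂μ ≤
      ∫⁻ _, ENNReal.ofReal (-Real.log d) ∂μ := by
    refine lintegral_mono_ae ?_
    filter_upwards [h] with x hx
    rw [toENNReal_neg_log_of_ne (fun h0 => by rw [h0, sub_self, abs_zero] at hx; linarith)]
    exact ENNReal.ofReal_le_ofReal (neg_le_neg (Real.log_le_log hd hx))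
  refine ne_top_of_le_ne_top ?_ h1
  rw [lintegral_const]
  finiteness

lemma ae_circle_le_of_essSup_eq {q s c : ℝ} {φ : ℂ → ℝ} (hs : circleMeasure s ≤ boundaryMeasure q)
    (hφ : MemLp φ ∞ (boundaryMeasure q)) (h : essSup φ (circleMeasure s) = c) :
    ∀ᵐ t ∂angleMeasure, φ (circleMap 0 s t) ≤ c := by
  obtain ⟨N, hN⟩ := exists_ae_abs_le hφ
  refine ae_of_ae_map (continuous_circleMap 0 s).aemeasurable (h ▸ ae_le_essSup ⟨N, ?_⟩)
  rw [eventually_map]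
  filter_upwards [ae_mono hs hN] with z hz using (le_abs_self _).trans hz

lemma ae_le_circle_of_essInf_eq {q s c : ℝ} {φ : ℂ → ℝ} (hs : circleMeasure s ≤ boundaryMeasure q)
    (hφ : MemLp φ ∞ (boundaryMeasure q)) (h : c = essInf φ (circleMeasure s)) :
    ∀ᵐ t ∂angleMeasure, c ≤ φ (circleMap 0 s t) := by
  obtain ⟨N, hN⟩ := exists_ae_abs_le hφ
  refine ae_of_ae_map (continuous_circleMap 0 s).aemeasurable (h ▸ ae_essInf_le ⟨-N, ?_⟩)
  rw [eventually_map]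
  filter_upwards [ae_mono hs hN] with z hz using neg_le_of_abs_le hz

end AnnulusToeplitz

open AnnulusToeplitz in
theorem corollary2p4 (q : ℝ) (hq0 : 0 < q) (hq1 : q < 1) (φ : ℂ → ℝ)
    (hφ : MemLp φ ∞ (AnnulusToeplitz.boundaryMeasure q)) (m M : ℝ) (hm : m < 0) (hM : 0 < M)
    (hsep :
      (essSup φ (AnnulusToeplitz.circleMeasure q) = m ∧
        M = essInf φ (AnnulusToeplitz.circleMeasure 1)) ∨
      (essSup φ (AnnulusToeplitz.circleMeasure 1) = m ∧
        M = essInf φ (AnnulusToeplitz.circleMeasure q)))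
    (hlog : AnnulusToeplitz.LogIntegralEqBot q φ M ∨ AnnulusToeplitz.LogIntegralEqBot q φ m)
    (α : ℝ) (hα : α ∈ Ico (0 : ℝ) 1) :
    {l : ℝ | l ∈ Ioo m M ∧
      Module.End.HasEigenvalue
        (AnnulusToeplitz.toeplitz q α hq0 hq1 φ hφ).toLinearMap (l : ℂ)}.Infinite := by
  have hmM : m < M := hm.trans hM
  obtain ⟨N, hN⟩ := exists_ae_abs_le hφ
  have hN₁ := ae_circle (circleMeasure_one_le q) hN
  have hN₂ := ae_circle (circleMeasure_le q) hN
  have hm₁ := (aestronglyMeasurable_circle (circleMeasure_one_le q) hφ.1).aemeasurable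
  have hm₂ := (aestronglyMeasurable_circle (circleMeasure_le q) hφ.1).aemeasurable
  -- On the circle across the gap from `c`, `φ` is at distance at least `M - m` from `c`, so the
  -- divergence must come from the other circle.
  have hfar : ∀ {f : ℝ → ℝ} {c : ℝ}, (∀ᵐ t ∂angleMeasure, M - m ≤ |f t - c|) →
      ∫⁻ t, (-ENNReal.log ‖f t - c‖ₑ).toENNReal ∂angleMeasure ≠ ∞ := fun h =>
    lintegral_neg_log_ne_top (by linarith) h
  have hc : 4 * Real.pi * Real.log q ≠ 0 := by
    have := (Real.log_neg hq0 hq1).ne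
    have := Real.pi_ne_zero
    positivity
  rcases hsep with ⟨hS, hI⟩ | ⟨hS, hI⟩
  · have hle := ae_circle_le_of_essSup_eq (circleMeasure_le q) hφ hS
    have hge := ae_le_circle_of_essInf_eq (circleMeasure_one_le q) hφ hI
    refine (infinite_setOf_integral_log_sub_eq hmM hm₁ hm₂ hN₁ hN₂ hge hle ?_ hc α).mono ?_
    · refine hlog.imp (fun h => ?_) (fun h => ?_)
      · refine (ENNReal.add_eq_top.mp (h.lintegral_add_eq_top hφ.1.aemeasurable)).resolve_right
          (hfar ?_)
        filter_upwards [hle] with t ht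
        exact le_abs.mpr (Or.inr (by linarith))
      · refine (ENNReal.add_eq_top.mp (h.lintegral_add_eq_top hφ.1.aemeasurable)).resolve_left
          (hfar ?_)
        filter_upwards [hge] with t ht
        exact le_abs.mpr (Or.inl (by linarith))
    · rintro l ⟨hl, k, hk⟩
      refine ⟨hl, hasEigenvalue_toeplitz (σ := 1) (δ := min (M - l) (l - m)) hq0 hq1 hφ
        (by norm_num) (lt_min (by linarith [hl.2]) (by linarith [hl.1])) ?_ ?_ hk ⟨k, rfl⟩⟩
      · filter_upwards [hge] with t ht
        exact (min_le_left _ _).trans (by linarith)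
      · filter_upwards [hle] with t ht
        exact (min_le_right _ _).trans (by linarith)
  · have hle := ae_circle_le_of_essSup_eq (circleMeasure_one_le q) hφ hS
    have hge := ae_le_circle_of_essInf_eq (circleMeasure_le q) hφ hI
    -- The large values now lie on `B_q`. The difference is inner minus outer, so the progression is
    -- negated, and `σ = -1` below.
    refine (infinite_setOf_integral_log_sub_eq hmM hm₂ hm₁ hN₂ hN₁ hge hle ?_
      (neg_ne_zero.mpr hc) α).mono ?_
    · refine hlog.imp (fun h => ?_) (fun h => ?_)
      · refine (ENNReal.add_eq_top.mp (h.lintegral_add_eq_top hφ.1.aemeasurable)).resolve_left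
          (hfar ?_)
        filter_upwards [hle] with t ht
        exact le_abs.mpr (Or.inr (by linarith))
      · refine (ENNReal.add_eq_top.mp (h.lintegral_add_eq_top hφ.1.aemeasurable)).resolve_right
          (hfar ?_)
        filter_upwards [hge] with t ht
        exact le_abs.mpr (Or.inl (by linarith))
    · rintro l ⟨hl, k, hk⟩
      refine ⟨hl, hasEigenvalue_toeplitz (σ := -1) (δ := min (M - l) (l - m)) (κ := α + k) hq0 hq1 hφ
        (by norm_num) (lt_min (by linarith [hl.2]) (by linarith [hl.1])) ?_ ?_ (by linarith)
        ⟨k, rfl⟩⟩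
      · filter_upwards [hle] with t ht
        exact (min_le_right _ _).trans (by linarith)
      · filter_upwards [hge] with t ht
        exact (min_le_left _ _).trans (by linarith)
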